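/- Let $X$ be a connected Riemann surface. A complex projective structure on $X$ is a maximal atlas of $\mathbb{CP}^1$-valued charts whose transition functions are locally restrictions of Möbius transformations; $\mathcal P(X)$ is the set of those whose charts are holomorphic on $X$; $\mathsf{M\ddot ob}(\sigma)$ is the group of self-maps (diffeomorphisms) that are locally Möbius in charts of $\sigma$; $\mathrm{Aut}(X)$ is the group of biholomorphisms of $X$. For $F\in\mathrm{Aut}(X)$, $F.\sigma$ is the structure with charts $\varphi\circ F^{-1}$, $\varphi$ a chart of $\sigma$ (if $\mathrm{dev}:\widetilde X\to\mathbb{CP}^1$ is a developing map of $\sigma$ and $\widetilde F$ a lift of $F$ to the universal cover, $\mathrm{dev}\circ\widetilde F^{-1}$ is a developing map of $F.\sigma$). For a holomorphic locally injective function $f$ of one complex variable let $\mathcal S(f)=\left(\frac{f''}{f'}\right)'-\frac12\left(\frac{f''}{f'}\right)^2$. Fix $\sigma_0\in\mathcal P(X)$. For $\sigma\in\mathcal P(X)$ let $\mathcal S_{\sigma_0}(\sigma)$ be the quadratic differential given, in a chart $z$ of $\sigma_0$ and with a chart $w$ of $\sigma$ (both composed with Möbius transformations so as to be finite at the point considered),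 by $\mathcal S(w\circ z^{-1})\,dz^2$. For $F\in \mathrm{Aut}(X)$ let $\mathcal S_{\sigma_0}(\widetilde F^{-1})$ be the quadratic differential given by $\mathcal S(z'\circ F^{-1}\circ z^{-1})\,dz^2$ with $z,z'$ such charts of $\sigma_0$. For a quadratic differential $q$ write $F^*q=q\circ F^{-1}$ for its pull-back along $F^{-1}$, and put $$F.q=F^*q+\mathcal S_{\sigma_0}(\widetilde F^{-1}).$$ Then: 1. $\mathcal S_{\sigma_0}(\sigma)$ and $\mathcal S_{\sigma_0}(\widetilde F^{-1})$ do not depend on the choice of charts and are holomorphic quadratic differentials on $X$. On any universal covering $\widetilde X\to X$ they are the Schwarzian derivatives, relative to $\sigma_0$, of any developing map $\mathrm{dev}$ of $\sigma$ and of $\mathrm{dev}_0\circ\widetilde F^{-1}$, for any developing map $\mathrm{dev}_0$ of $\sigma_0$ and any lift $\widetilde F$ of $F$, respectively; and $\mathrm{dev}\circ\widetilde F^{-1}$ is a developing map of $F.\sigma$. 2. $\sigma\mapsto\mathcal S_{\sigma_0}(\sigma)$ is a bijection $\mathcal P(X)\to H^0(X,K^2)$. 3. $F.\sigma\in\mathcal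 P(X)$ and $\mathcal S_{\sigma_0}(F.\sigma)=F.\mathcal S_{\sigma_0}(\sigma)$ for all $F\in\mathrm{Aut}(X)$, $\sigma\in\mathcal P(X)$. Both $F^*$ (linear) and $q\mapsto F.q$ (affine) preserve $H^0(X,K^2)$, and $(F,q)\mapsto F.q$ is a group action of $\mathrm{Aut}(X)$ on $H^0(X,K^2)$. 4. For every $F\in\mathrm{Aut}(X)$ and $\sigma\in\mathcal P(X)$, with $q=\mathcal S_{\sigma_0}(\sigma)$: $F\in\mathsf{M\ddot ob}(\sigma)$ if and only if $F.q=q$. -/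

import Mathlib

open Set Filter Topology
open scoped Manifold ContDiff

noncomputable section

namespace ProjStruct

/-! ### The Riemann sphere and Moebius transformations

`ℂℙ¹` is `OnePoint ℂ`, and `PSL₂(ℂ) = PGL₂(ℂ)` acts on it through Mathlib's action of `GL (Fin 2) ℂ`
by `z ↦ (a z + b) / (c z + d)`; scalar matrices act trivially, so a map is given by an element of
`PSL₂(ℂ)` iff it is given by an element of `GL (Fin 2) ℂ`. -/

/-- The Riemann sphere. -/
abbrev Sphere : Type := OnePoint ℂ

/-- Matrices representing Moebius transformations. -/
abbrev Moeb : Type := GL (Fin 2) ℂ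

/-- The affine coordinate on `ℂ ⊆ ℂℙ¹` (only used at finite points; the value at `∞` is junk). -/
def affine (p : Sphere) : ℂ := p.elim 0 id

/-- The Moebius transformation `z ↦ 1 / z`. -/
def inversion : Moeb := Matrix.GeneralLinearGroup.mkOfDetNeZero !![0, 1; 1, 0] (by simp)

/-- A Moebius transformation moving `p` to a finite point: `z ↦ 1 / z` if `p = ∞`, the identity
otherwise. -/
def toFinite (p : Sphere) : Moeb := by
  classical exact if p = OnePoint.infty then inversion else 1

lemma toFinite_smul_ne_infty (p : Sphere) : toFinite p • p ≠ OnePoint.infty := by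
  unfold toFinite
  split_ifs with h
  · subst h
    rw [Ne, OnePoint.smul_infty_eq_self_iff]
    simp [inversion, Matrix.GeneralLinearGroup.mkOfDetNeZero]
  · simpa using h

/-- Two `ℂℙ¹`-valued maps differ near `x` by post-composition with a Moebius transformation:
`f₂ = g ∘ f₁` near `x`. -/
def MoebRelated {X : Type*} [TopologicalSpace X] (f₁ f₂ : X → Sphere) (x : X) : Prop :=
  ∃ g : Moeb, ∀ᶠ y in 𝓝 x, f₂ y = g • f₁ y

/-! ### Complex projective structures -/

section Structures

variable {X : Type*} [TopologicalSpace X]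

/-- A complex projective structure on a surface: a maximal atlas of `ℂℙ¹`-valued charts whose
transition functions are (locally) restrictions of Moebius transformations. -/
@[ext]
structure ProjectiveStructure (X : Type*) [TopologicalSpace X] where
  charts : Set (OpenPartialHomeomorph X Sphere)
  cover : ∀ x : X, ∃ φ ∈ charts, x ∈ φ.source
  compatible : ∀ φ ∈ charts, ∀ ψ ∈ charts, ∀ x ∈ φ.source ∩ ψ.source, MoebRelated φ ψ x
  maximal : ∀ ψ : OpenPartialHomeomorph X Sphere,
    (∀ φ ∈ charts, ∀ x ∈ φ.source ∩ ψ.source, MoebRelated φ ψ x) → ψ ∈ charts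

namespace ProjectiveStructure

/-- A chart of `σ` around `x`. -/
def chart (σ : ProjectiveStructure X) (x : X) : OpenPartialHomeomorph X Sphere :=
  (σ.cover x).choose

lemma chart_mem (σ : ProjectiveStructure X) (x : X) : σ.chart x ∈ σ.charts :=
  (σ.cover x).choose_spec.1

lemma mem_chart_source (σ : ProjectiveStructure X) (x : X) : x ∈ (σ.chart x).source :=
  (σ.cover x).choose_spec.2

/-- The structure `F.σ`, whose charts are the `φ ∘ F⁻¹` for `φ` a chart of `σ`. -/
def push (F : X ≃ₜ X) (σ : ProjectiveStructure X) : ProjectiveStructure X where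
  charts := (fun φ => F.symm.transOpenPartialHomeomorph φ) '' σ.charts
  cover x := by
    obtain ⟨φ, hφ, hx⟩ := σ.cover (F.symm x)
    exact ⟨_, ⟨φ, hφ, rfl⟩, by simpa using hx⟩
  compatible := by
    rintro _ ⟨φ, hφ, rfl⟩ _ ⟨ψ, hψ, rfl⟩ x hx
    obtain ⟨g, hg⟩ := σ.compatible φ hφ ψ hψ (F.symm x) (by simpa using hx)
    exact ⟨g, (F.symm.continuous.tendsto x).eventually hg⟩
  maximal ψ hψ := by
    refine ⟨F.transOpenPartialHomeomorph ψ, σ.maximal _ fun φ hφ x hx => ?_, ?_⟩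
    · obtain ⟨g, hg⟩ := hψ _ ⟨φ, hφ, rfl⟩ (F x) (by simpa using hx)
      refine ⟨g, ((F.continuous.tendsto x).eventually hg).mono fun y hy => ?_⟩
      simpa using hy
    · refine OpenPartialHomeomorph.ext _ _ ?_ ?_ ?_ <;> intros <;> simp
      ext; simp

/-- `f` is projective for `σ`: in charts of `σ` it is (locally) a Moebius transformation. -/
def IsProjectiveMap (σ : ProjectiveStructure X) (f : X → X) : Prop :=
  ∀ φ ∈ σ.charts, ∀ ψ ∈ σ.charts, ∀ x ∈ φ.source, f x ∈ ψ.source → MoebRelated φ (ψ ∘ f) x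

/-- The projective automorphisms of `σ`. A homeomorphism which is locally Moebius in charts of `σ`
is automatically a diffeomorphism. -/
def Mob (σ : ProjectiveStructure X) : Set (X ≃ₜ X) := {F | σ.IsProjectiveMap F}

/-- `dev` is a developing map for `σ` on the covering `p : Y → X`: it is locally of the form
`φ ∘ p` with `φ` a chart of `σ`. -/
def IsDevelopingMap {Y : Type*} [TopologicalSpace Y] (σ : ProjectiveStructure X) (p : Y → X)
    (dev : Y → Sphere) : Prop :=
  ∀ y : Y, ∃ φ ∈ σ.charts, p y ∈ φ.source ∧ dev =ᶠ[𝓝 y] φ ∘ p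

end ProjectiveStructure

end Structures

/-! ### Riemann surfaces, quadratic differentials and the Schwarzian derivative -/

section RiemannSurface

variable (X : Type*) [TopologicalSpace X] [ChartedSpace ℂ X]

variable {X} in
/-- A `ℂℙ¹`-valued map is holomorphic at `x` if it is continuous there and some affine coordinate of
`ℂℙ¹` around its value (a Moebius image of the standard one) is a holomorphic function of it. -/
def HolomorphicAt (f : X → Sphere) (x : X) : Prop :=
  ContinuousAt f x ∧ ∃ g : Moeb, g • f x ≠ OnePoint.infty ∧
    MDifferentiableAt 𝓘(ℂ) 𝓘(ℂ) (fun y => affine (g • f y)) x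

/-- `𝒫(X)`: the projective structures whose underlying complex structure is the one of `X`, that
is, whose charts are holomorphic on `X`. -/
def P : Set (ProjectiveStructure X) :=
  {σ | ∀ φ ∈ σ.charts, ∀ x ∈ φ.source, HolomorphicAt φ x}

/-- The fibre at `x` of `K²`: bilinear forms on the (complex one-dimensional) tangent space. -/
abbrev KSqFibre (x : X) : Type :=
  TangentSpace 𝓘(ℂ) x →L[ℂ] TangentSpace 𝓘(ℂ) x →L[ℂ] ℂ

/-- Arbitrary sections of `K²`. -/
abbrev KSqSection : Type _ := ∀ x : X, KSqFibre X x

/-- The coefficient `h` of `q = h(z) dz²` in a complex chart `z = e`. -/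
def coeff (q : KSqSection X) (e : OpenPartialHomeomorph X ℂ) (t : ℂ) : ℂ :=
  q (e.symm t) (mfderiv 𝓘(ℂ) 𝓘(ℂ) e.symm t (1 : ℂ)) (mfderiv 𝓘(ℂ) 𝓘(ℂ) e.symm t (1 : ℂ))

/-- `H⁰(X, K²)`: the space of holomorphic quadratic differentials. -/
def H0K2 : Submodule ℂ (KSqSection X) where
  carrier := {q | ∀ e ∈ atlas ℂ X, DifferentiableOn ℂ (coeff X q e) e.target}
  add_mem' ha hb e he := (ha e he).add (hb e he)
  zero_mem' _ _ := differentiableOn_const (0 : ℂ)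
  smul_mem' c _ hq e he := (hq e he).const_smul c

/-- The Schwarzian derivative `(f'' / f')' - (f'' / f')² / 2` of a function of one complex
variable. -/
def schwarzian (f : ℂ → ℂ) (t : ℂ) : ℂ :=
  deriv (fun s => deriv (deriv f) s / deriv f s) t - 1 / 2 * (deriv (deriv f) t / deriv f t) ^ 2

variable {X}

/-- With `z = g ∘ φ` and `w = h ∘ f`, both regarded as `ℂ`-valued near `x`, the value at `x` of
`𝒮(w ∘ z⁻¹)(z) dz²`. It is meaningful when `x ∈ φ.source`, `g • φ x ≠ ∞` and `h • f x ≠ ∞`. -/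
def localSchwarzian (φ : OpenPartialHomeomorph X Sphere) (g h : Moeb) (f : X → Sphere) (x : X) :
    KSqFibre X x :=
  let dz : TangentSpace 𝓘(ℂ) x →L[ℂ] ℂ := mfderiv 𝓘(ℂ) 𝓘(ℂ) (fun y => affine (g • φ y)) x
  schwarzian (fun t => affine (h • f (φ.symm (g⁻¹ • (t : Sphere))))) (affine (g • φ x)) •
    dz.smulRight dz

/-- `b` is the value at `x` of the Schwarzian derivative, relative to `σ₀`, of the `ℂℙ¹`-valued germ
`f` at `x`, computed in whatever chart of `σ₀` and whatever affine coordinates on `ℂℙ¹`. -/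
def IsSchwarzianAt (σ₀ : ProjectiveStructure X) (f : X → Sphere) (x : X) (b : KSqFibre X x) :
    Prop :=
  ∀ φ ∈ σ₀.charts, x ∈ φ.source → ∀ g h : Moeb, g • φ x ≠ OnePoint.infty →
    h • f x ≠ OnePoint.infty → b = localSchwarzian φ g h f x

/-- The same for a `ℂℙ¹`-valued map `f` on a covering `p : Y → X`: every germ of `f`, carried down
to `X` by `p`, has Schwarzian derivative `q` relative to `σ₀`. -/
def IsSchwarzianOnCover {Y : Type*} [TopologicalSpace Y] (σ₀ : ProjectiveStructure X) (p : Y → X)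
    (f : Y → Sphere) (q : KSqSection X) : Prop :=
  ∀ (y : Y) (f' : X → Sphere), f =ᶠ[𝓝 y] f' ∘ p → IsSchwarzianAt σ₀ f' (p y) (q (p y))

/-- The Schwarzian derivative at `x`, relative to `σ₀`, of the `ℂℙ¹`-valued germ `f` at `x`. -/
def schwarzianAt (σ₀ : ProjectiveStructure X) (f : X → Sphere) (x : X) : KSqFibre X x :=
  localSchwarzian (σ₀.chart x) (toFinite (σ₀.chart x x)) (toFinite (f x)) f x

/-- `𝒮_{σ₀}(σ)`: the Schwarzian derivative of the charts of `σ` (the local branches of a developing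
map) relative to `σ₀`. -/
def S (σ₀ σ : ProjectiveStructure X) : KSqSection X :=
  fun x => schwarzianAt σ₀ (σ.chart x) x

/-- `Aut(X)`: the biholomorphisms of `X`. -/
abbrev Aut (X : Type*) [TopologicalSpace X] [ChartedSpace ℂ X] : Type _ :=
  X ≃ₘ^ω⟮𝓘(ℂ), 𝓘(ℂ)⟯ X

/-- `𝒮_{σ₀}(F⁻¹)`: the Schwarzian derivative of `F⁻¹` in charts of `σ₀` (at the source and at the
target). -/
def translation (σ₀ : ProjectiveStructure X) (F : Aut X) : KSqSection X :=
  fun x => schwarzianAt σ₀ (σ₀.chart (F.symm x) ∘ F.symm) x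

/-- The value at `x` of the pull-back of `q` along `F⁻¹`: the bilinear form
`(v, w) ↦ q (d(F⁻¹) v, d(F⁻¹) w)` on the tangent space at `x`. -/
def pullAt (F : Aut X) (q : KSqSection X) (x : X) : KSqFibre X x :=
  let D : TangentSpace 𝓘(ℂ) x →L[ℂ] TangentSpace 𝓘(ℂ) (F.symm x) := mfderiv 𝓘(ℂ) 𝓘(ℂ) F.symm x
  ((ContinuousLinearMap.precomp ℂ D).comp (q (F.symm x))).comp D

/-- The linear action `F^* q = q ∘ F⁻¹` of `F` on quadratic differentials, by pull-back along
`F⁻¹`. -/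
def pull (F : Aut X) : KSqSection X →ₗ[ℂ] KSqSection X where
  toFun q x := pullAt F q x
  map_add' _ _ := rfl
  map_smul' _ _ := rfl

/-- `F.q = F^* q + 𝒮_{σ₀}(F⁻¹)`. -/
def act (σ₀ : ProjectiveStructure X) (F : Aut X) (q : KSqSection X) : KSqSection X :=
  pull F q + translation σ₀ F

end RiemannSurface

end ProjStruct

end

noncomputable section

namespace ProjStruct

/-! ### The Schwarzian derivative in one complex variable -/

/-! Everything is reduced to functions of one variable. Along a holomorphic parametrization `γ` of
`X`, a conformal sphere-valued germ `f` has a number `sphereSchwarzian (f ∘ γ) t`. It ignores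
Moebius post-composition, because fractional linear maps have zero Schwarzian derivative. By the
chain rule, the Schwarzian derivative of `f` relative to a chart `φ` of `σ₀`, evaluated on the
velocity of `γ`, is the difference of the numbers of `f` and `φ`
(`IsParam.localSchwarzian_velocity`). The tangent space is a complex line, so this value determines
the quadratic form. Chart independence and holomorphy follow.

For injectivity of `S σ₀`, conformal maps with equal Schwarzian derivatives differ by a Moebius map
(`exists_fracLin_comp_of_schwarzian_eq`), and maximal atlases with Moebius-related charts coincide.
For surjectivity, a quotient of two solutions of `y'' = -H y / 2` has Schwarzian derivative `H`
(`exists_conformal_schwarzian_eq`), and the holomorphic charts with Schwarzian derivative `q` form a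
maximal atlas.

The translation part of `act` is `S σ₀` of the pushed structure `F.σ₀`, and the differences
telescope to `S σ₀ (F.σ) = F.(S σ₀ σ)` (`S_push`). The bijection then transports the group action
laws from structures to differentials. The criterion is the statement that `F` is projective exactly
when `F.σ = σ`. -/

/-- The pre-Schwarzian derivative `f'' / f'`. -/
def preSchwarzian (f : ℂ → ℂ) (t : ℂ) : ℂ := deriv (deriv f) t / deriv f t

lemma schwarzian_eq (f : ℂ → ℂ) (t : ℂ) :
    schwarzian f t = deriv (preSchwarzian f) t - 1 / 2 * preSchwarzian f t ^ 2 := rfl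

/-- `f` is holomorphic at `t` with nonzero derivative. -/
def Conformal (f : ℂ → ℂ) (t : ℂ) : Prop := AnalyticAt ℂ f t ∧ deriv f t ≠ 0

lemma Conformal.eventually {f : ℂ → ℂ} {t : ℂ} (hf : Conformal f t) :
    ∀ᶠ s in 𝓝 t, Conformal f s :=
  hf.1.eventually_analyticAt.and (hf.1.deriv.continuousAt.eventually_ne hf.2)

lemma Conformal.congr {f g : ℂ → ℂ} {t : ℂ} (hf : Conformal f t) (h : f =ᶠ[𝓝 t] g) :
    Conformal g t :=
  ⟨hf.1.congr h, h.deriv_eq ▸ hf.2⟩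

lemma Conformal.comp {f g : ℂ → ℂ} {t : ℂ} (hf : Conformal f (g t)) (hg : Conformal g t) :
    Conformal (f ∘ g) t := by
  refine ⟨hf.1.comp hg.1, ?_⟩
  rw [deriv_comp t hf.1.differentiableAt hg.1.differentiableAt]
  exact mul_ne_zero hf.2 hg.2

/-- Cancels a conformal inner map; this gives conformality of `w ∘ z⁻¹` from that of `w` and `z`
along a parametrization. -/
lemma Conformal.of_comp {f g : ℂ → ℂ} {t : ℂ} (hfg : Conformal (f ∘ g) t) (hg : Conformal g t) :
    Conformal f (g t) := by
  have hf := (analyticAt_comp_iff_of_deriv_ne_zero hg.1 hg.2).1 hfg.1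
  refine ⟨hf, fun h0 => hfg.2 ?_⟩
  rw [deriv_comp t hf.differentiableAt hg.1.differentiableAt, h0, zero_mul]

lemma Conformal.analyticAt_preSchwarzian {f : ℂ → ℂ} {t : ℂ} (hf : Conformal f t) :
    AnalyticAt ℂ (preSchwarzian f) t :=
  hf.1.deriv.deriv.div hf.1.deriv hf.2

lemma Conformal.analyticAt_schwarzian {f : ℂ → ℂ} {t : ℂ} (hf : Conformal f t) :
    AnalyticAt ℂ (schwarzian f) t :=
  hf.analyticAt_preSchwarzian.deriv.sub
    (analyticAt_const.mul (hf.analyticAt_preSchwarzian.pow 2))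

lemma preSchwarzian_congr {f g : ℂ → ℂ} {t : ℂ} (h : f =ᶠ[𝓝 t] g) :
    preSchwarzian f =ᶠ[𝓝 t] preSchwarzian g := by
  filter_upwards [h.deriv, h.deriv.deriv] with s h1 h2
  rw [preSchwarzian, preSchwarzian, h1, h2]

lemma schwarzian_congr {f g : ℂ → ℂ} {t : ℂ} (h : f =ᶠ[𝓝 t] g) :
    schwarzian f t = schwarzian g t := by
  rw [schwarzian_eq, schwarzian_eq, (preSchwarzian_congr h).deriv_eq,
    (preSchwarzian_congr h).eq_of_nhds]

lemma preSchwarzian_comp {f g : ℂ → ℂ} {t : ℂ} (hf : Conformal f (g t)) (hg : Conformal g t) :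
    preSchwarzian (f ∘ g) t = preSchwarzian f (g t) * deriv g t + preSchwarzian g t := by
  have h1 : deriv (f ∘ g) =ᶠ[𝓝 t] fun s => deriv f (g s) * deriv g s := by
    filter_upwards [hg.1.continuousAt.eventually hf.eventually, hg.eventually] with s h1 h2
    exact deriv_comp s h1.1.differentiableAt h2.1.differentiableAt
  have h2 : HasDerivAt (fun s => deriv f (g s) * deriv g s)
      (deriv (deriv f) (g t) * deriv g t * deriv g t + deriv f (g t) * deriv (deriv g) t) t :=
    (hf.1.deriv.differentiableAt.hasDerivAt.comp t hg.1.differentiableAt.hasDerivAt).mul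
      hg.1.deriv.differentiableAt.hasDerivAt
  rw [preSchwarzian, preSchwarzian, preSchwarzian, h1.deriv_eq, h1.eq_of_nhds, h2.deriv]
  have := hf.2
  have := hg.2
  field_simp

/-- The chain rule for the Schwarzian derivative. -/
lemma schwarzian_comp {f g : ℂ → ℂ} {t : ℂ} (hf : Conformal f (g t)) (hg : Conformal g t) :
    schwarzian (f ∘ g) t = schwarzian f (g t) * deriv g t ^ 2 + schwarzian g t := by
  have h1 : preSchwarzian (f ∘ g) =ᶠ[𝓝 t]
      fun s => preSchwarzian f (g s) * deriv g s + preSchwarzian g s := by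
    filter_upwards [hg.1.continuousAt.eventually hf.eventually, hg.eventually] with s h1 h2
    exact preSchwarzian_comp h1 h2
  have h2 : HasDerivAt (fun s => preSchwarzian f (g s) * deriv g s + preSchwarzian g s)
      (deriv (preSchwarzian f) (g t) * deriv g t * deriv g t
        + preSchwarzian f (g t) * deriv (deriv g) t + deriv (preSchwarzian g) t) t :=
    ((hf.analyticAt_preSchwarzian.differentiableAt.hasDerivAt.comp t
      hg.1.differentiableAt.hasDerivAt).mul hg.1.deriv.differentiableAt.hasDerivAt).add
      hg.analyticAt_preSchwarzian.differentiableAt.hasDerivAt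
  -- In this form the `g''` term cancels the cross term of the squared pre-Schwarzian.
  have h3 : deriv (deriv g) t = preSchwarzian g t * deriv g t := by
    rw [preSchwarzian, div_mul_cancel₀ _ hg.2]
  rw [schwarzian_eq, schwarzian_eq, schwarzian_eq, h1.deriv_eq, h1.eq_of_nhds, h2.deriv, h3]
  ring

/-- A fractional linear function. -/
def fracLin (a b c d s : ℂ) : ℂ := (a * s + b) / (c * s + d)

lemma hasDerivAt_fracLin {a b c d s : ℂ} (hs : c * s + d ≠ 0) :
    HasDerivAt (fracLin a b c d) ((a * d - b * c) / (c * s + d) ^ 2) s := by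
  have h := (((hasDerivAt_id s).const_mul a).add_const b).div
    (((hasDerivAt_id s).const_mul c).add_const d) hs
  refine h.congr_deriv ?_
  simp only [id]
  congr 1
  ring

lemma eventually_denom_ne_zero {c d s : ℂ} (hs : c * s + d ≠ 0) :
    ∀ᶠ r in 𝓝 s, c * r + d ≠ 0 :=
  ContinuousAt.eventually_ne (g := fun r => c * r + d) (by fun_prop) hs

lemma conformal_fracLin {a b c d s : ℂ} (hdet : a * d - b * c ≠ 0) (hs : c * s + d ≠ 0) :
    Conformal (fracLin a b c d) s := by
  refine ⟨AnalyticAt.div (by fun_prop) (by fun_prop) hs, ?_⟩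
  rw [(hasDerivAt_fracLin hs).deriv]
  exact div_ne_zero hdet (pow_ne_zero 2 hs)

lemma preSchwarzian_fracLin {a b c d s : ℂ} (hdet : a * d - b * c ≠ 0) (hs : c * s + d ≠ 0) :
    preSchwarzian (fracLin a b c d) s = -2 * c / (c * s + d) := by
  have h1 : deriv (fracLin a b c d) =ᶠ[𝓝 s] fun r => (a * d - b * c) / (c * r + d) ^ 2 := by
    filter_upwards [eventually_denom_ne_zero hs] with r hr using (hasDerivAt_fracLin hr).deriv
  have h2 : HasDerivAt (fun r => (a * d - b * c) / (c * r + d) ^ 2)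
      (-2 * c * (a * d - b * c) / (c * s + d) ^ 3) s := by
    have h := ((hasDerivAt_const s (a * d - b * c)).div
      ((((hasDerivAt_id s).const_mul c).add_const d).pow 2) (pow_ne_zero 2 hs))
    refine h.congr_deriv ?_
    simp
    field_simp
  rw [preSchwarzian, h1.deriv_eq, h1.eq_of_nhds, h2.deriv, div_div_div_eq,
    div_eq_div_iff (mul_ne_zero (pow_ne_zero 3 hs) hdet) hs]
  ring

lemma schwarzian_fracLin {a b c d s : ℂ} (hdet : a * d - b * c ≠ 0) (hs : c * s + d ≠ 0) :
    schwarzian (fracLin a b c d) s = 0 := by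
  have h1 : preSchwarzian (fracLin a b c d) =ᶠ[𝓝 s] fun r => -2 * c / (c * r + d) := by
    filter_upwards [eventually_denom_ne_zero hs] with r hr using preSchwarzian_fracLin hdet hr
  have h2 : HasDerivAt (fun r => -2 * c / (c * r + d)) (2 * c ^ 2 / (c * s + d) ^ 2) s := by
    have h := ((hasDerivAt_const s (-2 * c)).div
      (((hasDerivAt_id s).const_mul c).add_const d) hs)
    refine h.congr_deriv ?_
    simp
    ring
  rw [schwarzian_eq, h1.deriv_eq, h1.eq_of_nhds, h2.deriv]
  field_simp
  ring

lemma schwarzian_fracLin_comp {a b c d : ℂ} {f : ℂ → ℂ} {t : ℂ} (hdet : a * d - b * c ≠ 0)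
    (hf : Conformal f t) (ht : c * f t + d ≠ 0) :
    schwarzian (fracLin a b c d ∘ f) t = schwarzian f t := by
  rw [schwarzian_comp (conformal_fracLin hdet ht) hf, schwarzian_fracLin hdet ht, zero_mul,
    zero_add]

/-! ### Local solutions of the Schwarzian equation -/

/-- A holomorphic function which vanishes at a point and solves `d' = m d` vanishes nearby. -/
lemma eventually_eq_zero_of_deriv_eq_mul {d m : ℂ → ℂ} {t : ℂ} (hd : AnalyticAt ℂ d t)
    (hm : AnalyticAt ℂ m t) (h0 : d t = 0) (h : deriv d =ᶠ[𝓝 t] m * d) : ∀ᶠ s in 𝓝 t, d s = 0 := by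
  rw [← analyticOrderAt_eq_top]
  -- Order at least `n` for `d` gives order at least `n` for `d' = m d`; as `d t = 0`, integration
  -- raises the order of `d` to `n + 1`.
  refine ENat.eq_top_iff_forall_ge.2 fun n => ?_
  induction n with
  | zero => simp
  | succ n ih =>
    have h1 : (n : ℕ∞) ≤ analyticOrderAt (deriv d) t := by
      rw [analyticOrderAt_congr h, analyticOrderAt_mul hm hd]
      exact ih.trans le_add_self
    rw [natCast_le_analyticOrderAt_iff_iteratedDeriv_eq_zero hd.deriv] at h1
    rw [natCast_le_analyticOrderAt_iff_iteratedDeriv_eq_zero hd]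
    rintro (_ | i) hi
    · simpa using h0
    · rw [iteratedDeriv_succ']
      exact h1 i (by omega)

/-- Conformal maps with the same Schwarzian derivative differ by a fractional linear map. -/
lemma exists_fracLin_comp_of_schwarzian_eq {f₁ f₂ : ℂ → ℂ} {t : ℂ} (h₁ : Conformal f₁ t)
    (h₂ : Conformal f₂ t) (h : schwarzian f₁ =ᶠ[𝓝 t] schwarzian f₂) :
    ∃ a b c d : ℂ, a * d - b * c ≠ 0 ∧ c * f₁ t + d ≠ 0 ∧
      f₂ =ᶠ[𝓝 t] fracLin a b c d ∘ f₁ := by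
  -- Normalizing the denominator to be `1` at `f₁ t`, the fractional linear map has pre-Schwarzian
  -- `-2 * c` there. This `c` makes the pre-Schwarzians of the composite and of `f₂` agree at `t`.
  obtain ⟨c, hc⟩ : ∃ c, -2 * c * deriv f₁ t + preSchwarzian f₁ t = preSchwarzian f₂ t :=
    ⟨(preSchwarzian f₂ t - preSchwarzian f₁ t) / (-2 * deriv f₁ t), by
      have := h₁.2
      field_simp
      ring⟩
  set d := 1 - c * f₁ t with hd
  have ht : c * f₁ t + d ≠ 0 := by simp [hd]
  obtain ⟨a, b, hdet⟩ : ∃ a b : ℂ, a * d - b * c ≠ 0 := by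
    by_cases hc0 : c = 0
    · exact ⟨1, 0, by simp [hd, hc0]⟩
    · exact ⟨0, 1, by simpa using hc0⟩
  have hM := conformal_fracLin hdet ht
  have hk : Conformal (fracLin a b c d ∘ f₁) t := hM.comp h₁
  set k := fracLin a b c d ∘ f₁ with hkdef
  have hpre0 : preSchwarzian k t = preSchwarzian f₂ t := by
    rw [hkdef, preSchwarzian_comp hM h₁, preSchwarzian_fracLin hdet ht, ← hc]
    simp [hd]
  have hS : schwarzian k =ᶠ[𝓝 t] schwarzian f₂ := by
    refine EventuallyEq.trans ?_ h
    filter_upwards [h₁.eventually, h₁.1.continuousAt.eventually (eventually_denom_ne_zero ht)]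
      with s hs hs' using schwarzian_fracLin_comp hdet hs hs'
  -- Equality of Schwarzians says that the difference of the pre-Schwarzians has derivative half the
  -- difference of their squares, a linear equation for that difference.
  have hpre : ∀ᶠ s in 𝓝 t, (preSchwarzian k - preSchwarzian f₂) s = 0 := by
    refine eventually_eq_zero_of_deriv_eq_mul
      (m := fun s => 1 / 2 * (preSchwarzian k s + preSchwarzian f₂ s))
      (hk.analyticAt_preSchwarzian.sub h₂.analyticAt_preSchwarzian)
      (analyticAt_const.mul (hk.analyticAt_preSchwarzian.add h₂.analyticAt_preSchwarzian))
      (by simp [hpre0]) ?_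
    filter_upwards [hS, hk.eventually, h₂.eventually] with s hs h1 h2
    rw [schwarzian_eq, schwarzian_eq] at hs
    rw [deriv_sub h1.analyticAt_preSchwarzian.differentiableAt
      h2.analyticAt_preSchwarzian.differentiableAt]
    simp only [Pi.mul_apply, Pi.sub_apply]
    linear_combination hs
  set e := deriv f₂ t / deriv k t with he
  have hk0 := hk.2
  have he0 : e ≠ 0 := div_ne_zero h₂.2 hk0
  -- Both derivatives now solve `u' = preSchwarzian f₂ * u`, and `e` matches their values at `t`.
  have hder : ∀ᶠ s in 𝓝 t, (fun s => deriv f₂ s - e * deriv k s) s = 0 := by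
    refine eventually_eq_zero_of_deriv_eq_mul (m := preSchwarzian f₂)
      (h₂.1.deriv.sub (analyticAt_const.mul hk.1.deriv)) h₂.analyticAt_preSchwarzian
      (by simp [he, div_mul_cancel₀ _ hk0]) ?_
    filter_upwards [hpre, hk.eventually, h₂.eventually] with s hs h1 h2
    rw [((h2.1.deriv.differentiableAt.hasDerivAt).fun_sub
      (h1.1.deriv.differentiableAt.hasDerivAt.const_mul e)).deriv]
    have e1 : deriv (deriv f₂) s = preSchwarzian f₂ s * deriv f₂ s := by
      rw [preSchwarzian, div_mul_cancel₀ _ h2.2]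
    have e2 : deriv (deriv k) s = preSchwarzian f₂ s * deriv k s := by
      rw [← sub_eq_zero.1 (show preSchwarzian k s - preSchwarzian f₂ s = 0 from hs),
        preSchwarzian, div_mul_cancel₀ _ h1.2]
    simp only [Pi.mul_apply, e1, e2]
    ring
  have hval : ∀ᶠ s in 𝓝 t, (fun s => f₂ s - f₂ t - e * (k s - k t)) s = 0 := by
    refine eventually_eq_zero_of_deriv_eq_mul (m := fun _ => 0)
      ((h₂.1.sub analyticAt_const).sub (analyticAt_const.mul (hk.1.sub analyticAt_const)))
      analyticAt_const (by simp) ?_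
    filter_upwards [hder, hk.eventually, h₂.eventually] with s hs h1 h2
    rw [((h2.1.differentiableAt.hasDerivAt.sub_const _).fun_sub
      ((h1.1.differentiableAt.hasDerivAt.sub_const _).const_mul e)).deriv]
    simpa using hs
  set l := f₂ t - e * k t with hl
  refine ⟨e * a + l * c, e * b + l * d, c, d, ?_, ht, ?_⟩
  · convert mul_ne_zero he0 hdet using 1
    ring
  · filter_upwards [hval, h₁.1.continuousAt.eventually (eventually_denom_ne_zero ht)] with s hs hs'
    have hs1 : f₂ s = e * k s + l := by
      simp only [hl]
      linear_combination hs
    rw [hs1, hkdef]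
    simp only [Function.comp, fracLin]
    rw [eq_div_iff hs', add_mul, mul_assoc, div_mul_cancel₀ _ hs']
    ring

/-- Taylor coefficients of the solution of `y'' = H y` with `y(t) = a`, `y'(t) = b`, where `h` are
the Taylor coefficients of `H` at `t`. -/
def odeCoeff (h : ℕ → ℂ) (a b : ℂ) : ℕ → ℂ
  | 0 => a
  | 1 => b
  | n + 2 => (∑ i : Fin (n + 1), h (n - i) * odeCoeff h a b i) / ((n + 1) * (n + 2))

lemma odeCoeff_add_two (h : ℕ → ℂ) (a b : ℂ) (n : ℕ) :
    (n + 1) * (n + 2) * odeCoeff h a b (n + 2) =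
      ∑ i ∈ Finset.range (n + 1), h (n - i) * odeCoeff h a b i := by
  have h1 : (n + 1 : ℂ) ≠ 0 := by exact_mod_cast Nat.succ_ne_zero n
  have h2 : (n + 2 : ℂ) ≠ 0 := by exact_mod_cast Nat.succ_ne_zero (n + 1)
  rw [odeCoeff, Finset.sum_range]
  field_simp

/-- Each of the `n + 1` terms of the recursion is at most `C * A * R ^ n`. The rate `R = ρ * (1 +
C)` satisfies `ρ ≤ R` and `C ≤ R ^ 2`, so the jump from `n` to `n + 2` absorbs `C`, and the
denominator absorbs the number of terms. -/
lemma norm_odeCoeff_le {h : ℕ → ℂ} {C ρ : ℝ} (hρ : 1 ≤ ρ) (hC : 0 ≤ C)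
    (hh : ∀ n, ‖h n‖ ≤ C * ρ ^ n) (a b : ℂ) :
    ∀ n, ‖odeCoeff h a b n‖ ≤ (‖a‖ + ‖b‖) * (ρ * (1 + C)) ^ n := by
  intro n
  set R := ρ * (1 + C) with hR
  have hρR : ρ ≤ R := by nlinarith
  have hR1 : 1 ≤ R := hρ.trans hρR
  set A := ‖a‖ + ‖b‖ with hA
  have hA0 : 0 ≤ A := by positivity
  induction n using Nat.strong_induction_on with
  | _ n ih =>
  match n with
  | 0 => simp [odeCoeff, hA]
  | 1 =>
    rw [odeCoeff, pow_one]
    calc ‖b‖ ≤ A := by simp [hA]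
      _ ≤ A * R := le_mul_of_one_le_right hA0 hR1
  | n + 2 =>
    have hn : ‖((n + 1) * (n + 2) : ℂ)‖ = (n + 1) * (n + 2) := by
      rw [norm_mul]
      congr 1
      · exact_mod_cast Complex.norm_natCast (n + 1)
      · exact_mod_cast Complex.norm_natCast (n + 2)
    rw [odeCoeff, norm_div, hn, div_le_iff₀ (by positivity)]
    have hterm : ∀ i : Fin (n + 1), ‖h (n - i) * odeCoeff h a b i‖ ≤ C * A * R ^ n := by
      intro i
      have hi : (i : ℕ) ≤ n := Nat.lt_succ_iff.1 i.2
      calc ‖h (n - i) * odeCoeff h a b i‖ ≤ (C * ρ ^ (n - i : ℕ)) * (A * R ^ (i : ℕ)) := by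
            rw [norm_mul]
            gcongr
            · exact hh _
            · exact ih i (by omega)
        _ ≤ (C * R ^ (n - i : ℕ)) * (A * R ^ (i : ℕ)) := by gcongr
        _ = C * A * (R ^ (n - i : ℕ) * R ^ (i : ℕ)) := by ring
        _ = C * A * R ^ n := by rw [← pow_add, Nat.sub_add_cancel hi]
    have hCR : C ≤ R ^ 2 := by nlinarith
    calc ‖∑ i : Fin (n + 1), h (n - i) * odeCoeff h a b i‖
        ≤ ∑ i : Fin (n + 1), C * A * R ^ n := norm_sum_le_of_le _ fun i _ => hterm i
      _ = C * (A * R ^ n) * (n + 1) := by simp; ring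
      _ ≤ R ^ 2 * (A * R ^ n) * (n + 1) := by gcongr
      _ ≤ R ^ 2 * (A * R ^ n) * ((n + 1) * (n + 2)) := by
          gcongr
          nlinarith [(Nat.cast_nonneg n : (0 : ℝ) ≤ n)]
      _ = A * R ^ (n + 2) * ((n + 1) * (n + 2)) := by ring

/-- A geometric bound for the Taylor coefficients of a holomorphic function. -/
lemma exists_bound_taylor {H : ℂ → ℂ} {t : ℂ} (hH : AnalyticAt ℂ H t) :
    ∃ C ρ : ℝ, 1 ≤ ρ ∧ 0 ≤ C ∧ ∀ n, ‖iteratedDeriv n H t / n.factorial‖ ≤ C * ρ ^ n := by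
  obtain ⟨r, hr⟩ := hH.hasFPowerSeriesAt
  obtain ⟨r', hr'0, hr'⟩ := ENNReal.lt_iff_exists_nnreal_btwn.1 (hr.r_pos.trans_le hr.r_le)
  obtain ⟨C, hC, hb⟩ := FormalMultilinearSeries.norm_mul_pow_le_of_lt_radius _ hr'
  have hr0 : (0 : ℝ) < r' := by exact_mod_cast hr'0
  -- The maximum with `1` supplies the condition `1 ≤ ρ` of `norm_odeCoeff_le`.
  refine ⟨C, max 1 (r' : ℝ)⁻¹, le_max_left _ _, hC.le, fun n => ?_⟩
  have h := hb n
  rw [FormalMultilinearSeries.ofScalars_norm] at h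
  calc _ ≤ C / (r' : ℝ) ^ n := (le_div_iff₀ (by positivity)).2 h
    _ = C * ((r' : ℝ)⁻¹) ^ n := by rw [inv_pow, div_eq_mul_inv]
    _ ≤ _ := by gcongr; exact le_max_right _ _

/-- The geometric bound gives the power series a positive radius of convergence; uniqueness of power
series identifies its coefficients with the Taylor coefficients of its sum. -/
lemma exists_analyticAt_iteratedDeriv_eq {c : ℕ → ℂ} {A R : ℝ} (hR : 0 < R)
    (hc : ∀ n, ‖c n‖ ≤ A * R ^ n) (t : ℂ) :
    ∃ y : ℂ → ℂ, AnalyticAt ℂ y t ∧ ∀ n, iteratedDeriv n y t = n.factorial * c n := by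
  set p := FormalMultilinearSeries.ofScalars ℂ c with hp
  have hrad : 0 < p.radius := by
    refine lt_of_lt_of_le ?_ (p.le_radius_of_bound A (r := Real.toNNReal R⁻¹) fun n => ?_)
    · simpa using hR
    · rw [hp, FormalMultilinearSeries.ofScalars_norm, Real.coe_toNNReal _ (by positivity), inv_pow,
        ← div_eq_mul_inv, div_le_iff₀ (by positivity)]
      exact hc n
  have h := (p.hasFPowerSeriesOnBall hrad).comp_sub t
  rw [zero_add] at h
  have hy := h.hasFPowerSeriesAt
  refine ⟨_, hy.analyticAt, fun n => ?_⟩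
  have h2 := hy.eq_formalMultilinearSeries hy.analyticAt.hasFPowerSeriesAt
  have h3 := congrArg (fun q => q.coeff n) h2
  simp only [hp, FormalMultilinearSeries.coeff_ofScalars] at h3
  rw [h3, mul_div_cancel₀]
  exact_mod_cast n.factorial_ne_zero

/-- Local existence for the linear equation `y'' = H y`. -/
lemma exists_linear_ode {H : ℂ → ℂ} {t : ℂ} (hH : AnalyticAt ℂ H t) (a b : ℂ) :
    ∃ y : ℂ → ℂ, AnalyticAt ℂ y t ∧ y t = a ∧ deriv y t = b ∧
      deriv (deriv y) =ᶠ[𝓝 t] fun s => H s * y s := by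
  obtain ⟨C, ρ, hρ, hC, hb⟩ := exists_bound_taylor hH
  obtain ⟨y, hy, hyd⟩ := exists_analyticAt_iteratedDeriv_eq
    (by positivity) (norm_odeCoeff_le hρ hC hb a b) t
  refine ⟨y, hy, by simpa [odeCoeff] using hyd 0, by simpa [odeCoeff] using hyd 1, ?_⟩
  have hd : AnalyticAt ℂ (deriv (deriv y) - fun s => H s * y s) t := hy.deriv.deriv.sub (hH.mul hy)
  -- All derivatives of `y'' - H y` vanish at `t`: by the Leibniz rule this is the recursion for
  -- `odeCoeff`, with the summation index reflected.
  suffices hs : ∀ᶠ s in 𝓝 t, (deriv (deriv y) - fun s => H s * y s) s = 0 by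
    filter_upwards [hs] with s hs using sub_eq_zero.1 hs
  rw [← analyticOrderAt_eq_top]
  refine ENat.eq_top_iff_forall_ge.2 fun m => ?_
  rw [natCast_le_analyticOrderAt_iff_iteratedDeriv_eq_zero hd]
  intro n _
  rw [iteratedDeriv_sub (g := fun s => H s * y s) hy.deriv.deriv.contDiffAt
    (hH.mul hy).contDiffAt, sub_eq_zero,
    ← iteratedDeriv_succ', ← iteratedDeriv_succ', hyd, iteratedDeriv_fun_mul hH.contDiffAt
    hy.contDiffAt, ← Finset.sum_range_reflect]
  have hf : ((n + 2).factorial : ℂ) = (n + 1) * (n + 2) * n.factorial := by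
    rw [Nat.factorial_succ, Nat.factorial_succ]
    push_cast
    ring
  rw [hf, mul_right_comm, odeCoeff_add_two, Finset.sum_mul]
  refine Finset.sum_congr rfl fun i hi => ?_
  have hi' : i ≤ n := Nat.lt_succ_iff.1 (Finset.mem_range.1 hi)
  have e1 : n + 1 - 1 - i = n - i := by omega
  have e2 : n - (n - i) = i := by omega
  rw [e1, e2, hyd, Nat.choose_symm hi', Nat.cast_choose ℂ hi']
  have := Nat.cast_ne_zero (R := ℂ).2 (Nat.factorial_ne_zero i)
  have := Nat.cast_ne_zero (R := ℂ).2 (Nat.factorial_ne_zero (n - i))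
  field_simp

/-- Local existence for the Schwarzian equation. -/
lemma exists_conformal_schwarzian_eq {H : ℂ → ℂ} {t : ℂ} (hH : AnalyticAt ℂ H t) :
    ∃ f : ℂ → ℂ, Conformal f t ∧ schwarzian f =ᶠ[𝓝 t] H := by
  -- The initial values `(0, 1)` for `y` and `(1, 0)` for `v` keep the denominator `v` nonzero at
  -- `t` and make the Wronskian `1`. Hence `(y / v)' = 1 / v ^ 2`, with pre-Schwarzian `-2 * v' /
  -- v`.
  obtain ⟨y, hy, hy0, hy1, hyy⟩ :=
    exists_linear_ode (analyticAt_const (v := (-1 / 2 : ℂ)) |>.fun_mul hH) 0 1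
  obtain ⟨v, hv, hv0, hv1, hvv⟩ :=
    exists_linear_ode (analyticAt_const (v := (-1 / 2 : ℂ)) |>.fun_mul hH) 1 0
  have hv00 : v t ≠ 0 := by simp [hv0]
  have hvn : ∀ᶠ s in 𝓝 t, v s ≠ 0 := hv.continuousAt.eventually_ne hv00
  have hW : ∀ᶠ s in 𝓝 t, (fun s => deriv y s * v s - y s * deriv v s - 1) s = 0 := by
    refine eventually_eq_zero_of_deriv_eq_mul (m := fun _ => 0)
      (((hy.deriv.mul hv).sub (hy.mul hv.deriv)).sub analyticAt_const)
      analyticAt_const (by simp [hy0, hy1, hv0, hv1]) ?_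
    filter_upwards [hyy, hvv, hy.eventually_analyticAt, hv.eventually_analyticAt] with s h1 h2 h3 h4
    have h := (((h3.deriv.differentiableAt.hasDerivAt.mul h4.differentiableAt.hasDerivAt).sub
      (h3.differentiableAt.hasDerivAt.mul h4.deriv.differentiableAt.hasDerivAt)).sub_const 1).deriv
    refine Eq.trans h ?_
    rw [h1, h2]
    simp only [Pi.mul_apply]
    ring
  have hder : deriv (fun s => y s / v s) =ᶠ[𝓝 t] fun s => 1 / v s ^ 2 := by
    filter_upwards [hW, hvn, hy.eventually_analyticAt, hv.eventually_analyticAt] with s h1 h2 h3 h4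
    rw [(h3.differentiableAt.hasDerivAt.fun_div h4.differentiableAt.hasDerivAt h2).deriv]
    congr 1
    linear_combination h1
  have hpre : preSchwarzian (fun s => y s / v s) =ᶠ[𝓝 t] fun s => -2 * deriv v s / v s := by
    filter_upwards [hder.deriv, hder, hvn, hv.eventually_analyticAt] with s h1 h2 h3 h4
    have h := ((hasDerivAt_const s (1 : ℂ)).fun_div
      (h4.differentiableAt.hasDerivAt.fun_pow 2) (pow_ne_zero 2 h3)).deriv
    rw [preSchwarzian, h1, h2, h]
    simp
    field_simp
  refine ⟨fun s => y s / v s, ⟨hy.div hv hv00, ?_⟩, ?_⟩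
  · rw [hder.eq_of_nhds]
    simp [hv0]
  · filter_upwards [hpre.deriv, hpre, hvn, hv.eventually_analyticAt, hvv] with s h1 h2 h3 h4 h5
    have h := ((h4.deriv.differentiableAt.hasDerivAt.const_mul (-2)).fun_div
      h4.differentiableAt.hasDerivAt h3).deriv
    rw [schwarzian_eq, h1, h2, h, h5]
    field_simp
    ring

/-! ### Injective holomorphic functions -/

/-- Near `t` a nonconstant `f` is `f t + g t * r ^ n` in a local coordinate `r`. Multiplying `r` by
a primitive `n`-th root of unity preserves `f`, so injectivity forces `n = 1`. -/
lemma deriv_ne_zero_of_injOn {f : ℂ → ℂ} {t : ℂ} {U : Set ℂ} (hf : AnalyticAt ℂ f t)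
    (hU : U ∈ 𝓝 t) (hinj : InjOn f U) : deriv f t ≠ 0 := by
  have hnc : ¬ ∀ᶠ s in 𝓝 t, f s - f t = 0 := by
    intro h
    have h2 : ∀ᶠ s in 𝓝 t, s = t := by
      filter_upwards [h, hU] with s hs hsU
      exact hinj hsU (mem_of_mem_nhds hU) (sub_eq_zero.1 hs)
    have h3 := h2.filter_mono (nhdsWithin_le_nhds (s := {t}ᶜ))
    obtain ⟨s, hs, hs'⟩ := (h3.and self_mem_nhdsWithin).exists
    exact hs' hs
  obtain ⟨n, g, hg, hg0, hfg⟩ :=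
    ((hf.sub analyticAt_const).exists_eventuallyEq_pow_smul_nonzero_iff).2 hnc
  have hn0 : n ≠ 0 := by
    rintro rfl
    exact hg0 (by simpa using hfg.self_of_nhds.symm)
  have hn : (n : ℂ) ≠ 0 := Nat.cast_ne_zero.2 hn0
  -- Dividing by `g t` puts the argument of the logarithm near `1`, so the `n`-th root is analytic.
  set r : ℂ → ℂ := fun s => (s - t) * Complex.exp (Complex.log (g s / g t) / n) with hr
  have hslit : g t / g t ∈ Complex.slitPlane := by simp [hg0]
  have hra : AnalyticAt ℂ (fun s => Complex.exp (Complex.log (g s / g t) / n)) t :=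
    (((hg.div analyticAt_const hg0).clog hslit).div analyticAt_const hn).cexp
  have hrd : HasStrictDerivAt r 1 t := by
    have h : HasStrictDerivAt r _ t :=
      HasStrictDerivAt.fun_mul ((hasStrictDerivAt_id t).sub_const t) hra.hasStrictDerivAt
    refine h.congr_deriv ?_
    simp [hg0]
  have hr0 : r t = 0 := by simp [hr]
  have hfr : ∀ᶠ s in 𝓝 t, f s = f t + g t * r s ^ n := by
    filter_upwards [hfg, hg.continuousAt.eventually_ne hg0] with s hs hs0
    have hs' : f s - f t = (s - t) ^ n * g s := hs
    have : Complex.exp (Complex.log (g s / g t) / n) ^ n = g s / g t := by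
      rw [← Complex.exp_nat_mul, mul_div_cancel₀ _ hn, Complex.exp_log (div_ne_zero hs0 hg0)]
    rw [hr]
    simp only [mul_pow, this]
    field_simp
    linear_combination hs'
  have himg : r '' (U ∩ {s | f s = f t + g t * r s ^ n}) ∈ 𝓝 (0 : ℂ) := by
    rw [← hr0, ← hrd.map_nhds_eq one_ne_zero]
    exact image_mem_map (inter_mem hU hfr)
  have hζ := Complex.isPrimitiveRoot_exp n hn0
  set ζ := Complex.exp (2 * Real.pi * Complex.I / n)
  have himg2 : ∀ᶠ s in 𝓝 (0 : ℂ), ζ * s ∈ r '' (U ∩ {s | f s = f t + g t * r s ^ n}) := by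
    have : Tendsto (fun s => ζ * s) (𝓝 0) (𝓝 0) := by
      simpa using (continuous_const_mul ζ).tendsto 0
    exact this himg
  have h3 := (Filter.Eventually.and himg himg2).filter_mono (nhdsWithin_le_nhds (s := {0}ᶜ))
  obtain ⟨s, ⟨⟨p, ⟨hpU, hp⟩, hps⟩, ⟨q, ⟨hqU, hq⟩, hqs⟩⟩, hs0⟩ := (h3.and self_mem_nhdsWithin).exists
  have hpq : f p = f q := by
    rw [mem_ofPred_eq] at hp hq
    rw [hp, hq, hqs, hps, mul_pow, hζ.pow_eq_one, one_mul]
  have hpq' := hinj hpU hqU hpq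
  have hζ1 : ζ = 1 := by
    have h4 : ζ * s = 1 * s := by rw [one_mul, ← hqs, ← hps, hpq']
    exact mul_right_cancel₀ hs0 h4
  have hn1 : n = 1 := by
    rw [hζ1] at hζ
    exact hζ.unique IsPrimitiveRoot.one
  subst hn1
  have hfr' : f =ᶠ[𝓝 t] fun s => f t + g t * r s := by
    filter_upwards [hfr] with s hs
    rwa [pow_one] at hs
  rw [hfr'.deriv_eq, ((hrd.hasDerivAt.const_mul (g t)).const_add (f t)).deriv]
  simpa using hg0

/-! ### Sphere-valued functions of one complex variable -/

@[simp]
lemma affine_coe (z : ℂ) : affine (z : Sphere) = z := rfl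

lemma coe_affine {p : Sphere} (hp : p ≠ OnePoint.infty) : (affine p : Sphere) = p := by
  induction p using OnePoint.rec with
  | infty => exact absurd rfl hp
  | coe z => rfl

lemma affine_injOn : InjOn affine {p : Sphere | p ≠ OnePoint.infty} := fun p hp q hq h => by
  rw [← coe_affine hp, ← coe_affine hq, h]

lemma isOpen_smul_ne_infty (h : Moeb) : IsOpen {p : Sphere | h • p ≠ OnePoint.infty} := by
  have : {p : Sphere | h • p ≠ OnePoint.infty} = {h⁻¹ • (OnePoint.infty : Sphere)}ᶜ := by
    ext p
    simp [eq_inv_smul_iff]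
  rw [this]
  exact isOpen_compl_singleton

lemma det_fin_two_ne_zero (M : Moeb) : M 0 0 * M 1 1 - M 0 1 * M 1 0 ≠ 0 := by
  rw [← Matrix.det_fin_two]
  exact M.det_ne_zero

lemma smul_coe_ne_infty_iff (M : Moeb) (z : ℂ) :
    M • (z : Sphere) ≠ OnePoint.infty ↔ M 1 0 * z + M 1 1 ≠ 0 := by
  rw [OnePoint.smul_some_eq_ite]
  split_ifs with h <;> simp [h]

lemma smul_coe_of_ne_zero {M : Moeb} {z : ℂ} (h : M 1 0 * z + M 1 1 ≠ 0) :
    M • (z : Sphere) = (fracLin (M 0 0) (M 0 1) (M 1 0) (M 1 1) z : ℂ) := by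
  rw [OnePoint.smul_some_eq_ite, if_neg h]
  rfl

lemma smul_eq_smul_coe_affine (g h : Moeb) {p : Sphere} (hg : g • p ≠ OnePoint.infty) :
    h • p = (h * g⁻¹) • (affine (g • p) : Sphere) := by
  rw [coe_affine hg, mul_smul, inv_smul_smul]

/-- The affine coordinate of `h ∘ F`. -/
def coord {Y : Type*} (h : Moeb) (F : Y → Sphere) (t : Y) : ℂ := affine (h • F t)

/-- `F` is a conformal map to the sphere at `t`. -/
def SphereConformal (F : ℂ → Sphere) (t : ℂ) : Prop :=
  ∃ h : Moeb, (∀ᶠ s in 𝓝 t, h • F s ≠ OnePoint.infty) ∧ Conformal (coord h F) t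

/-- The Schwarzian derivative of a sphere-valued function. -/
def sphereSchwarzian (F : ℂ → Sphere) (t : ℂ) : ℂ := schwarzian (coord (toFinite (F t)) F) t

namespace SphereConformal

variable {F G : ℂ → Sphere} {t : ℂ}

/-- The two affine coordinates differ by the fractional linear map of `h * g⁻¹`, whose denominator
is nonzero because `h • F t` is finite. -/
lemma change_coord {g h : Moeb} (hg : ∀ᶠ s in 𝓝 t, g • F s ≠ OnePoint.infty)
    (hF : Conformal (coord g F) t) (hh : h • F t ≠ OnePoint.infty) :
    (∀ᶠ s in 𝓝 t, h • F s ≠ OnePoint.infty) ∧ Conformal (coord h F) t ∧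
      schwarzian (coord h F) t = schwarzian (coord g F) t := by
  set M := h * g⁻¹ with hM
  have ht : M 1 0 * coord g F t + M 1 1 ≠ 0 := by
    rw [← smul_coe_ne_infty_iff, coord, ← smul_eq_smul_coe_affine _ _ hg.self_of_nhds]
    exact hh
  have hev := hF.1.continuousAt.eventually (eventually_denom_ne_zero ht)
  have heq : coord h F =ᶠ[𝓝 t] fracLin (M 0 0) (M 0 1) (M 1 0) (M 1 1) ∘ coord g F := by
    filter_upwards [hg, hev] with s h1 h2
    rw [coord, smul_eq_smul_coe_affine g h h1]
    exact congrArg affine (smul_coe_of_ne_zero h2)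
  refine ⟨?_, ((conformal_fracLin (det_fin_two_ne_zero M) ht).comp hF).congr heq.symm, ?_⟩
  · filter_upwards [hg, hev] with s h1 h2
    rw [smul_eq_smul_coe_affine g h h1]
    exact (smul_coe_ne_infty_iff _ _).2 h2
  · rw [schwarzian_congr heq, schwarzian_fracLin_comp (det_fin_two_ne_zero M) hF ht]

lemma eventually_smul_ne_infty (hF : SphereConformal F t) {h : Moeb}
    (hh : h • F t ≠ OnePoint.infty) : ∀ᶠ s in 𝓝 t, h • F s ≠ OnePoint.infty := by
  obtain ⟨g, hg, hc⟩ := hF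
  exact (change_coord hg hc hh).1

lemma conformal_coord (hF : SphereConformal F t) {h : Moeb}
    (hh : h • F t ≠ OnePoint.infty) : Conformal (coord h F) t := by
  obtain ⟨g, hg, hc⟩ := hF
  exact (change_coord hg hc hh).2.1

lemma schwarzian_coord (hF : SphereConformal F t) {h : Moeb}
    (hh : h • F t ≠ OnePoint.infty) : schwarzian (coord h F) t = sphereSchwarzian F t := by
  obtain ⟨g, hg, hc⟩ := hF
  rw [sphereSchwarzian, (change_coord hg hc hh).2.2,
    (change_coord hg hc (toFinite_smul_ne_infty (F t))).2.2]

lemma eventually (hF : SphereConformal F t) : ∀ᶠ s in 𝓝 t, SphereConformal F s := by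
  obtain ⟨g, hg, hc⟩ := hF
  filter_upwards [hg.eventually_nhds, hc.eventually] with s h1 h2 using ⟨g, h1, h2⟩

lemma congr (hF : SphereConformal F t) (h : F =ᶠ[𝓝 t] G) : SphereConformal G t := by
  obtain ⟨g, hg, hc⟩ := hF
  refine ⟨g, ?_, hc.congr ?_⟩
  · filter_upwards [hg, h] with s h1 h2
    rwa [← h2]
  · filter_upwards [h] with s h2
    rw [coord, coord, h2]

lemma sphereSchwarzian_smul (hF : SphereConformal F t) (g : Moeb) :
    sphereSchwarzian (fun s => g • F s) t = sphereSchwarzian F t := by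
  have h := toFinite_smul_ne_infty (g • F t)
  rw [smul_smul] at h
  rw [← hF.schwarzian_coord h, sphereSchwarzian]
  refine congrArg (schwarzian · t) (funext fun s => ?_)
  rw [coord, coord, mul_smul]

lemma analyticAt_sphereSchwarzian (hF : SphereConformal F t) :
    AnalyticAt ℂ (sphereSchwarzian F) t := by
  have h := toFinite_smul_ne_infty (F t)
  refine (hF.conformal_coord h).analyticAt_schwarzian.congr ?_
  filter_upwards [hF.eventually, hF.eventually_smul_ne_infty h] with s h1 h2
    using h1.schwarzian_coord h2

end SphereConformal

lemma sphereSchwarzian_congr {F G : ℂ → Sphere} {t : ℂ} (h : F =ᶠ[𝓝 t] G) :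
    sphereSchwarzian F t = sphereSchwarzian G t := by
  rw [sphereSchwarzian, sphereSchwarzian, h.eq_of_nhds]
  refine schwarzian_congr ?_
  filter_upwards [h] with s hs
  rw [coord, coord, hs]

lemma coord_one_coe (f : ℂ → ℂ) : coord 1 (fun s => (f s : Sphere)) = f := by
  funext s
  rw [coord, one_smul, affine_coe]

lemma Conformal.sphereConformal {f : ℂ → ℂ} {t : ℂ} (hf : Conformal f t) :
    SphereConformal (fun s => (f s : Sphere)) t :=
  ⟨1, by simp, by rwa [coord_one_coe]⟩

lemma Conformal.sphereSchwarzian_coe {f : ℂ → ℂ} {t : ℂ} (hf : Conformal f t) :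
    sphereSchwarzian (fun s => (f s : Sphere)) t = schwarzian f t := by
  rw [← hf.sphereConformal.schwarzian_coord (h := 1) (by simp), coord_one_coe]

/-- Conformal maps to the sphere with the same Schwarzian derivative differ by a Moebius
transformation. -/
lemma SphereConformal.exists_smul_eq {F G : ℂ → Sphere} {t : ℂ} (hF : SphereConformal F t)
    (hG : SphereConformal G t) (h : sphereSchwarzian F =ᶠ[𝓝 t] sphereSchwarzian G) :
    ∃ g : Moeb, ∀ᶠ s in 𝓝 t, G s = g • F s := by
  have hf := toFinite_smul_ne_infty (F t)
  have hg := toFinite_smul_ne_infty (G t)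
  set f := toFinite (F t)
  set k := toFinite (G t)
  have hFf := hF.eventually_smul_ne_infty hf
  have hGk := hG.eventually_smul_ne_infty hg
  obtain ⟨a, b, c, d, hdet, hden, heq⟩ :=
    exists_fracLin_comp_of_schwarzian_eq (hF.conformal_coord hf) (hG.conformal_coord hg) (by
      filter_upwards [h, hF.eventually, hG.eventually, hFf, hGk] with s h1 h2 h3 h4 h5
      rw [h2.schwarzian_coord h4, h3.schwarzian_coord h5, h1])
  set M : Moeb := Matrix.GeneralLinearGroup.mkOfDetNeZero !![a, b; c, d]
    (by rwa [Matrix.det_fin_two_of]) with hM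
  refine ⟨k⁻¹ * M * f, ?_⟩
  filter_upwards [heq, hFf, hGk, (hF.conformal_coord hf).1.continuousAt.eventually
    (eventually_denom_ne_zero hden)] with s h1 h2 h3 h4
  rw [mul_smul, mul_smul, eq_inv_smul_iff, ← coe_affine h2, ← coe_affine h3,
    smul_coe_of_ne_zero (M := M) (z := affine (f • F s)) (by exact h4)]
  exact congrArg OnePoint.some h1

section

/-! ### Sphere-valued maps on a Riemann surface -/

variable {X : Type*} [TopologicalSpace X] [ChartedSpace ℂ X]

lemma HolomorphicAt.mdifferentiableAt_coord {f : X → Sphere} {x : X} (hf : HolomorphicAt f x)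
    {h : Moeb} (hh : h • f x ≠ OnePoint.infty) :
    MDifferentiableAt 𝓘(ℂ) 𝓘(ℂ) (coord h f) x := by
  obtain ⟨hcont, g, hg, hd⟩ := hf
  set M := h * g⁻¹ with hM
  have hx : M 1 0 * affine (g • f x) + M 1 1 ≠ 0 := by
    rw [← smul_coe_ne_infty_iff, ← smul_eq_smul_coe_affine _ _ hg]
    exact hh
  have hF := (conformal_fracLin (det_fin_two_ne_zero M) hx).1.differentiableAt
  have hcomp := (hF.mdifferentiableAt).comp x hd
  refine hcomp.congr_of_eventuallyEq ?_
  filter_upwards [hcont.eventually ((isOpen_smul_ne_infty g).mem_nhds hg),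
    hd.continuousAt.eventually (eventually_denom_ne_zero hx)] with y h1 h2
  rw [coord, smul_eq_smul_coe_affine g h h1]
  exact congrArg affine (smul_coe_of_ne_zero h2)

lemma HolomorphicAt.congr {f f' : X → Sphere} {x : X} (hf : HolomorphicAt f x)
    (h : f =ᶠ[𝓝 x] f') : HolomorphicAt f' x := by
  obtain ⟨hcont, g, hg, hd⟩ := hf
  refine ⟨hcont.congr h, g, h.eq_of_nhds ▸ hg, hd.congr_of_eventuallyEq ?_⟩
  filter_upwards [h] with y hy
  rw [hy]

/-- `f` is holomorphic and injective near `x`. -/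
def ConformalAt (f : X → Sphere) (x : X) : Prop :=
  (∀ᶠ y in 𝓝 x, HolomorphicAt f y) ∧ ∃ U ∈ 𝓝 x, InjOn f U

lemma ConformalAt.congr {f f' : X → Sphere} {x : X} (hf : ConformalAt f x)
    (h : f =ᶠ[𝓝 x] f') : ConformalAt f' x := by
  obtain ⟨hhol, U, hU, hinj⟩ := hf
  refine ⟨?_, U ∩ {y | f y = f' y}, inter_mem hU h, fun y hy z hz hyz => ?_⟩
  · filter_upwards [hhol, h.eventuallyEq_nhds] with y h1 h2 using h1.congr h2
  · exact hinj hy.1 hz.1 (hy.2.trans (hyz.trans hz.2.symm))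

lemma ConformalAt.eventually {f : X → Sphere} {x : X} (hf : ConformalAt f x) :
    ∀ᶠ y in 𝓝 x, ConformalAt f y := by
  obtain ⟨hhol, U, hU, hinj⟩ := hf
  filter_upwards [hhol.eventually_nhds, eventually_mem_nhds_iff.2 hU] with y h1 h2
    using ⟨h1, U, h2, hinj⟩

lemma conformalAt_of_holomorphicAt {φ : OpenPartialHomeomorph X Sphere}
    (hφ : ∀ y ∈ φ.source, HolomorphicAt φ y) {x : X} (hx : x ∈ φ.source) : ConformalAt φ x :=
  ⟨eventually_of_mem (φ.open_source.mem_nhds hx) hφ, φ.source, φ.open_source.mem_nhds hx, φ.injOn⟩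

lemma conformalAt_of_mem_P {σ : ProjectiveStructure X} (hσ : σ ∈ P X)
    {φ : OpenPartialHomeomorph X Sphere} (hφ : φ ∈ σ.charts) {x : X} (hx : x ∈ φ.source) :
    ConformalAt φ x :=
  conformalAt_of_holomorphicAt (hσ φ hφ) hx

/-- `γ` is a holomorphic parametrization of `X` near `t`. -/
def IsParam (γ : ℂ → X) (t : ℂ) : Prop :=
  (∀ᶠ s in 𝓝 t, MDifferentiableAt 𝓘(ℂ) 𝓘(ℂ) γ s) ∧ ∃ U ∈ 𝓝 t, InjOn γ U

namespace IsParam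

variable {γ : ℂ → X} {t : ℂ}

lemma continuousAt (hγ : IsParam γ t) : ContinuousAt γ t :=
  hγ.1.self_of_nhds.continuousAt

lemma eventually (hγ : IsParam γ t) : ∀ᶠ s in 𝓝 t, IsParam γ s := by
  obtain ⟨hd, U, hU, hinj⟩ := hγ
  filter_upwards [hd.eventually_nhds, eventually_mem_nhds_iff.2 hU] with s h1 h2
    using ⟨h1, U, h2, hinj⟩

lemma of_atlas [IsManifold 𝓘(ℂ) ω X] {e : OpenPartialHomeomorph X ℂ} (he : e ∈ atlas ℂ X)
    (ht : t ∈ e.target) : IsParam e.symm t := by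
  have : IsManifold 𝓘(ℂ) 1 X := IsManifold.of_le (n := ω) le_top
  refine ⟨?_, e.target, e.open_target.mem_nhds ht, e.symm.injOn⟩
  filter_upwards [e.open_target.mem_nhds ht] with s hs using mdifferentiableAt_atlas_symm he hs

lemma _root_.ProjStruct.exists_isParam [IsManifold 𝓘(ℂ) ω X] (x : X) :
    ∃ (γ : ℂ → X) (t : ℂ), IsParam γ t ∧ γ t = x :=
  ⟨(chartAt ℂ x).symm, chartAt ℂ x x,
    of_atlas (chart_mem_atlas ℂ x) (mem_chart_target ℂ x),
    (chartAt ℂ x).left_inv (mem_chart_source ℂ x)⟩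

lemma comp_aut (hγ : IsParam γ t) (F : Aut X) : IsParam (F ∘ γ) t := by
  obtain ⟨hd, U, hU, hinj⟩ := hγ
  refine ⟨?_, U, hU, F.injective.comp_injOn hinj⟩
  filter_upwards [hd] with s hs
  exact (F.mdifferentiable (by simp) (γ s)).comp s hs

/-- The velocity of a parametrization. -/
def _root_.ProjStruct.velocity (γ : ℂ → X) (t : ℂ) : TangentSpace 𝓘(ℂ) (γ t) :=
  mfderiv 𝓘(ℂ) 𝓘(ℂ) γ t (1 : ℂ)

lemma mfderiv_velocity {f : X → ℂ} (hγ : IsParam γ t)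
    (hf : MDifferentiableAt 𝓘(ℂ) 𝓘(ℂ) f (γ t)) :
    mfderiv 𝓘(ℂ) 𝓘(ℂ) f (γ t) (velocity γ t) = deriv (f ∘ γ) t := by
  have h := mfderiv_comp_apply t hf hγ.1.self_of_nhds (1 : ℂ)
  rw [mfderiv_eq_fderiv] at h
  exact h.symm.trans (fderiv_apply_one_eq_deriv (𝕜 := ℂ) (f := f ∘ γ))

/-- Charts and parametrizations are only known to be holomorphic and injective;
`deriv_ne_zero_of_injOn` supplies the nonzero derivative. -/
lemma sphereConformal (hγ : IsParam γ t) {f : X → Sphere} (hf : ConformalAt f (γ t)) :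
    SphereConformal (f ∘ γ) t := by
  obtain ⟨hhol, U, hU, hinj⟩ := hf
  have hh := toFinite_smul_ne_infty (f (γ t))
  set h := toFinite (f (γ t))
  have hne : ∀ᶠ y in 𝓝 (γ t), h • f y ≠ OnePoint.infty :=
    hhol.self_of_nhds.1.eventually ((isOpen_smul_ne_infty h).mem_nhds hh)
  have han : AnalyticAt ℂ (coord h (f ∘ γ)) t := by
    rw [Complex.analyticAt_iff_eventually_differentiableAt]
    filter_upwards [hγ.continuousAt.eventually hne, hγ.continuousAt.eventually hhol, hγ.1]
      with s h1 h2 h3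
    exact ((h2.mdifferentiableAt_coord h1).comp s h3).differentiableAt
  obtain ⟨V, hV, hVinj⟩ := hγ.2
  refine ⟨h, hγ.continuousAt.eventually hne, han, deriv_ne_zero_of_injOn han
    (inter_mem hV (hγ.continuousAt (inter_mem hU hne))) fun a ha b hb hab => ?_⟩
  exact hVinj ha.1 hb.1 (hinj ha.2.1 hb.2.1
    (smul_left_cancel h (affine_injOn ha.2.2 hb.2.2 hab)))

lemma sphereSchwarzian_eq_of_moebRelated (hγ : IsParam γ t) {f f' : X → Sphere}
    (hf : ConformalAt f (γ t)) (h : MoebRelated f f' (γ t)) :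
    sphereSchwarzian (f' ∘ γ) t = sphereSchwarzian (f ∘ γ) t := by
  obtain ⟨g, hg⟩ := h
  rw [← (hγ.sphereConformal hf).sphereSchwarzian_smul g]
  exact sphereSchwarzian_congr (hγ.continuousAt.eventually hg)

/-- The Schwarzian derivative relative to a chart `φ`, evaluated on the velocity of `γ`. -/
lemma localSchwarzian_velocity (hγ : IsParam γ t) {φ : OpenPartialHomeomorph X Sphere}
    (hφ : ConformalAt φ (γ t)) (ht : γ t ∈ φ.source) {f : X → Sphere} (hf : ConformalAt f (γ t))
    {g h : Moeb} (hg : g • φ (γ t) ≠ OnePoint.infty) (hh : h • f (γ t) ≠ OnePoint.infty) :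
    localSchwarzian φ g h f (γ t) (velocity γ t) (velocity γ t) =
      sphereSchwarzian (f ∘ γ) t - sphereSchwarzian (φ ∘ γ) t := by
  have hk := (hγ.sphereConformal hφ).conformal_coord hg
  have hw := (hγ.sphereConformal hf).conformal_coord hh
  -- This is `w ∘ z⁻¹`. Along `γ`, composing it with `z` gives `w`, and the chain rule for that
  -- composite is the claim.
  set W : ℂ → ℂ := fun z => affine (h • f (φ.symm (g⁻¹ • (z : Sphere)))) with hW
  have hWk : W ∘ coord g (φ ∘ γ) =ᶠ[𝓝 t] coord h (f ∘ γ) := by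
    filter_upwards [(hγ.sphereConformal hφ).eventually_smul_ne_infty hg,
      hγ.continuousAt (φ.open_source.mem_nhds ht)] with s h1 h2
    have h1' : g • φ (γ s) ≠ OnePoint.infty := h1
    simp only [hW, coord, Function.comp]
    rw [coe_affine h1', inv_smul_smul, φ.left_inv h2]
  have hWc : Conformal W (coord g (φ ∘ γ) t) := (hw.congr hWk.symm).of_comp hk
  let dz : TangentSpace 𝓘(ℂ) (γ t) →L[ℂ] ℂ := mfderiv 𝓘(ℂ) 𝓘(ℂ) (coord g φ) (γ t)
  have hdz : dz (velocity γ t) = deriv (coord g (φ ∘ γ)) t :=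
    hγ.mfderiv_velocity (hφ.1.self_of_nhds.mdifferentiableAt_coord hg)
  rw [← (hγ.sphereConformal hf).schwarzian_coord hh, ← (hγ.sphereConformal hφ).schwarzian_coord hg,
    ← schwarzian_congr hWk, schwarzian_comp hWc hk, add_sub_cancel_right]
  change schwarzian W (coord g (φ ∘ γ) t) * (dz (velocity γ t) * dz (velocity γ t)) = _
  rw [hdz, pow_two]

lemma velocity_ne_zero (hγ : IsParam γ t) {f : X → Sphere} (hf : ConformalAt f (γ t)) :
    velocity γ t ≠ 0 := by
  have hh := toFinite_smul_ne_infty (f (γ t))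
  intro h0
  have h := hγ.mfderiv_velocity (hf.1.self_of_nhds.mdifferentiableAt_coord hh)
  rw [h0, map_zero] at h
  exact ((hγ.sphereConformal hf).conformal_coord hh).2 h.symm

end IsParam

lemma KSqFibre.ext_of_ne_zero {x : X} {b b' : KSqFibre X x} {v : TangentSpace 𝓘(ℂ) x} (hv : v ≠ 0)
    (h : b v v = b' v v) : b = b' := by
  -- Division is available in `ℂ`; the result passes to the tangent space because that space unfolds
  -- to `ℂ`.
  have key : ∀ u w : ℂ, u ≠ 0 → ∃ c : ℂ, w = c • u := fun u w hu =>
    ⟨w / u, (div_mul_cancel₀ w hu).symm⟩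
  replace key : ∀ w : TangentSpace 𝓘(ℂ) x, ∃ c : ℂ, w = c • v := fun w => key v w hv
  refine ContinuousLinearMap.ext fun w => ContinuousLinearMap.ext fun w' => ?_
  obtain ⟨c, rfl⟩ := key w
  obtain ⟨c', rfl⟩ := key w'
  simp [h]

/-! ### Schwarzian derivatives of germs relative to `σ₀` -/

section Schwarzian

variable {σ₀ : ProjectiveStructure X} {γ : ℂ → X} {t : ℂ}

lemma IsSchwarzianAt.apply_velocity (hσ₀ : σ₀ ∈ P X) (hγ : IsParam γ t) {f : X → Sphere}
    (hf : ConformalAt f (γ t)) {φ : OpenPartialHomeomorph X Sphere} (hφ : φ ∈ σ₀.charts)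
    (ht : γ t ∈ φ.source) {b : KSqFibre X (γ t)} (hb : IsSchwarzianAt σ₀ f (γ t) b) :
    b (velocity γ t) (velocity γ t) =
      sphereSchwarzian (f ∘ γ) t - sphereSchwarzian (φ ∘ γ) t := by
  have hg := toFinite_smul_ne_infty (φ (γ t))
  have hh := toFinite_smul_ne_infty (f (γ t))
  rw [hb φ hφ ht _ _ hg hh]
  exact hγ.localSchwarzian_velocity (conformalAt_of_mem_P hσ₀ hφ ht) ht hf hg hh

/-- One chart of `σ₀` and one velocity suffice: another chart of `σ₀` is Moebius-related to `φ`, so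
the subtracted term is the same, and the affine coordinates do not enter the formula. -/
lemma isSchwarzianAt_of_apply_velocity (hσ₀ : σ₀ ∈ P X) (hγ : IsParam γ t) {f : X → Sphere}
    (hf : ConformalAt f (γ t)) {φ : OpenPartialHomeomorph X Sphere} (hφ : φ ∈ σ₀.charts)
    (ht : γ t ∈ φ.source) {b : KSqFibre X (γ t)}
    (hb : b (velocity γ t) (velocity γ t) =
      sphereSchwarzian (f ∘ γ) t - sphereSchwarzian (φ ∘ γ) t) :
    IsSchwarzianAt σ₀ f (γ t) b := by
  intro ψ hψ hx g h hg hh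
  have hcφ := conformalAt_of_mem_P hσ₀ hφ ht
  have hcψ := conformalAt_of_mem_P hσ₀ hψ hx
  refine KSqFibre.ext_of_ne_zero (hγ.velocity_ne_zero hf) ?_
  rw [hb, hγ.localSchwarzian_velocity hcψ hx hf hg hh,
    hγ.sphereSchwarzian_eq_of_moebRelated hcφ (σ₀.compatible φ hφ ψ hψ _ ⟨ht, hx⟩)]

lemma isSchwarzianAt_schwarzianAt [IsManifold 𝓘(ℂ) ω X] (hσ₀ : σ₀ ∈ P X) {f : X → Sphere} {x : X}
    (hf : ConformalAt f x) : IsSchwarzianAt σ₀ f x (schwarzianAt σ₀ f x) := by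
  obtain ⟨γ, t, hγ, rfl⟩ := exists_isParam x
  have ht := σ₀.mem_chart_source (γ t)
  have hφ := σ₀.chart_mem (γ t)
  exact isSchwarzianAt_of_apply_velocity hσ₀ hγ hf hφ ht
    (hγ.localSchwarzian_velocity (conformalAt_of_mem_P hσ₀ hφ ht) ht hf
      (toFinite_smul_ne_infty _) (toFinite_smul_ne_infty _))

lemma IsSchwarzianAt.of_moebRelated [IsManifold 𝓘(ℂ) ω X] (hσ₀ : σ₀ ∈ P X) {f f' : X → Sphere}
    {x : X} (hf : ConformalAt f x) (hf' : ConformalAt f' x) (h : MoebRelated f f' x)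
    {b : KSqFibre X x} (hb : IsSchwarzianAt σ₀ f x b) : IsSchwarzianAt σ₀ f' x b := by
  obtain ⟨γ, t, hγ, rfl⟩ := exists_isParam x
  have ht := σ₀.mem_chart_source (γ t)
  have hφ := σ₀.chart_mem (γ t)
  refine isSchwarzianAt_of_apply_velocity hσ₀ hγ hf' hφ ht ?_
  rw [hb.apply_velocity hσ₀ hγ hf hφ ht, hγ.sphereSchwarzian_eq_of_moebRelated hf h]

lemma moebRelated_of_eventuallyEq {X : Type*} [TopologicalSpace X] {f f' : X → Sphere} {x : X}
    (h : f =ᶠ[𝓝 x] f') :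
    MoebRelated f f' x :=
  ⟨1, by filter_upwards [h] with y hy; rw [hy, one_smul]⟩

lemma IsSchwarzianAt.congr [IsManifold 𝓘(ℂ) ω X] (hσ₀ : σ₀ ∈ P X) {f f' : X → Sphere} {x : X}
    (hf : ConformalAt f x) (h : f =ᶠ[𝓝 x] f') {b : KSqFibre X x} (hb : IsSchwarzianAt σ₀ f x b) :
    IsSchwarzianAt σ₀ f' x b :=
  hb.of_moebRelated hσ₀ hf (hf.congr h) (moebRelated_of_eventuallyEq h)

lemma IsSchwarzianAt.unique [IsManifold 𝓘(ℂ) ω X] {f : X → Sphere} {x : X} {b b' : KSqFibre X x}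
    (hb : IsSchwarzianAt σ₀ f x b) (hb' : IsSchwarzianAt σ₀ f x b') : b = b' := by
  have h := toFinite_smul_ne_infty (σ₀.chart x x)
  have h' := toFinite_smul_ne_infty (f x)
  rw [hb _ (σ₀.chart_mem x) (σ₀.mem_chart_source x) _ _ h h',
    hb' _ (σ₀.chart_mem x) (σ₀.mem_chart_source x) _ _ h h']

/-- Germs with the same Schwarzian derivative relative to `σ₀` are related by a Moebius
transformation. -/
lemma moebRelated_of_isSchwarzianAt [IsManifold 𝓘(ℂ) ω X] (hσ₀ : σ₀ ∈ P X) {f f' : X → Sphere}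
    {x : X} (hf : ConformalAt f x) (hf' : ConformalAt f' x) {q : KSqSection X}
    (h : ∀ᶠ y in 𝓝 x, IsSchwarzianAt σ₀ f y (q y))
    (h' : ∀ᶠ y in 𝓝 x, IsSchwarzianAt σ₀ f' y (q y)) : MoebRelated f f' x := by
  set e := chartAt ℂ x
  have hγ : IsParam e.symm (e x) := IsParam.of_atlas (chart_mem_atlas ℂ x) (mem_chart_target ℂ x)
  have hx : e.symm (e x) = x := e.left_inv (mem_chart_source ℂ x)
  have htend : Tendsto e.symm (𝓝 (e x)) (𝓝 x) := by simpa only [hx] using hγ.continuousAt.tendsto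
  -- At each nearby parameter the same chart of `σ₀` is subtracted for `f` and `f'`, so their sphere
  -- Schwarzians along `e.symm` agree.
  obtain ⟨g, hg⟩ := (hγ.sphereConformal (hx.symm ▸ hf)).exists_smul_eq
    (hγ.sphereConformal (f := f') (hx.symm ▸ hf')) (by
      filter_upwards [hγ.eventually, htend.eventually h, htend.eventually h',
        htend.eventually hf.eventually, htend.eventually hf'.eventually] with s h1 h2 h3 h4 h5
      have hφ := σ₀.chart_mem (e.symm s)
      have hs := σ₀.mem_chart_source (e.symm s)
      have e1 := h2.apply_velocity hσ₀ h1 h4 hφ hs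
      have e2 := h3.apply_velocity hσ₀ h1 h5 hφ hs
      exact sub_left_injective (e1.symm.trans e2))
  refine ⟨g, ?_⟩
  filter_upwards [(e.continuousAt (mem_chart_source ℂ x)).eventually hg,
    e.open_source.mem_nhds (mem_chart_source ℂ x)] with y h1 h2
  simpa only [Function.comp, e.left_inv h2] using h1

end Schwarzian

end

section

/-! ### Moebius-related germs and maximal atlases -/

section MoebRelated

variable {X Y : Type*} [TopologicalSpace X] [TopologicalSpace Y]

lemma MoebRelated.symm {f f' : X → Sphere} {x : X} (h : MoebRelated f f' x) :
    MoebRelated f' f x := by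
  obtain ⟨g, hg⟩ := h
  refine ⟨g⁻¹, ?_⟩
  filter_upwards [hg] with y hy
  rw [hy, inv_smul_smul]

lemma MoebRelated.comp {f f' : X → Sphere} {k : Y → X} {y : Y} (h : MoebRelated f f' (k y))
    (hk : ContinuousAt k y) : MoebRelated (f ∘ k) (f' ∘ k) y := by
  obtain ⟨g, hg⟩ := h
  exact ⟨g, hk.eventually hg⟩

namespace ProjectiveStructure

/-- Maximality of each atlas absorbs the charts of the other. -/
lemma eq_of_moebRelated {σ σ' : ProjectiveStructure X}
    (h : ∀ φ ∈ σ.charts, ∀ ψ ∈ σ'.charts, ∀ x ∈ φ.source ∩ ψ.source, MoebRelated φ ψ x) :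
    σ = σ' := by
  refine ProjectiveStructure.ext (Subset.antisymm ?_ ?_)
  · intro φ hφ
    exact σ'.maximal φ fun ψ hψ x hx => (h φ hφ ψ hψ x ⟨hx.2, hx.1⟩).symm
  · intro ψ hψ
    exact σ.maximal ψ fun φ hφ x hx => h φ hφ ψ hψ x hx

lemma push_refl (σ : ProjectiveStructure X) : σ.push (Homeomorph.refl X) = σ := by
  refine eq_of_moebRelated ?_
  rintro _ ⟨φ, hφ, rfl⟩ ψ hψ x hx
  exact σ.compatible φ hφ ψ hψ x hx

lemma push_trans (σ : ProjectiveStructure X) (F G : X ≃ₜ X) :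
    σ.push (G.trans F) = (σ.push G).push F := by
  refine eq_of_moebRelated ?_
  rintro _ ⟨φ, hφ, rfl⟩ _ ⟨_, ⟨ψ, hψ, rfl⟩, rfl⟩ x hx
  exact (σ.compatible φ hφ ψ hψ (G.symm (F.symm x)) hx).comp (k := G.symm ∘ F.symm)
    (G.symm.continuous.comp F.symm.continuous).continuousAt

/-- Precomposition with `F` or `F⁻¹` exchanges the relation between `φ` and `ψ ∘ F` with the
relation between `φ ∘ F⁻¹` and `ψ`. -/
lemma mem_Mob_iff {σ : ProjectiveStructure X} {F : X ≃ₜ X} : F ∈ σ.Mob ↔ σ.push F = σ := by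
  constructor
  · intro h
    refine eq_of_moebRelated ?_
    rintro _ ⟨φ, hφ, rfl⟩ ψ hψ x hx
    have h1 := h φ hφ ψ hψ (F.symm x) hx.1 (by simpa using hx.2)
    have h2 := h1.comp F.symm.continuous.continuousAt
    have h3 : (ψ ∘ F) ∘ F.symm = ψ := by
      funext y
      simp
    rwa [h3] at h2
  · intro h φ hφ ψ hψ x hx hFx
    have hmem : F.symm.transOpenPartialHomeomorph φ ∈ σ.charts := by
      rw [← h]
      exact ⟨φ, hφ, rfl⟩
    have h1 := (σ.compatible _ hmem ψ hψ (F x) ⟨by simpa using hx, hFx⟩).comp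
      F.continuous.continuousAt
    have h3 : (F.symm.transOpenPartialHomeomorph φ) ∘ F = φ := by
      funext y
      simp
    rwa [h3] at h1

lemma IsDevelopingMap.push {σ : ProjectiveStructure X} {p : Y → X} {dev : Y → Sphere}
    (h : σ.IsDevelopingMap p dev) {F : X ≃ₜ X} {Ft : Y ≃ₜ Y} (hF : ∀ y, p (Ft y) = F (p y)) :
    (σ.push F).IsDevelopingMap p (dev ∘ Ft.symm) := by
  intro y
  have hp : ∀ y, p (Ft.symm y) = F.symm (p y) := fun y => by
    rw [F.eq_symm_apply, ← hF, Ft.apply_symm_apply]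
  obtain ⟨φ, hφ, hy, heq⟩ := h (Ft.symm y)
  refine ⟨_, ⟨φ, hφ, rfl⟩, by simpa [hp] using hy, ?_⟩
  filter_upwards [Ft.symm.continuous.continuousAt.eventually heq] with z hz
  simpa [hp] using hz

end ProjectiveStructure

end MoebRelated

/-! ### The Schwarzian parametrization of projective structures -/

variable {X : Type*} [TopologicalSpace X] [ChartedSpace ℂ X]

lemma HolomorphicAt.of_moebRelated {f f' : X → Sphere} {x : X} (hf : HolomorphicAt f x)
    (hf' : ContinuousAt f' x) (h : MoebRelated f f' x) : HolomorphicAt f' x := by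
  obtain ⟨_, g, hg, hd⟩ := hf
  obtain ⟨k, hk⟩ := h
  refine ⟨hf', g * k⁻¹, ?_, hd.congr_of_eventuallyEq ?_⟩
  · rw [hk.self_of_nhds, mul_smul, inv_smul_smul]
    exact hg
  · filter_upwards [hk] with y hy
    rw [hy, mul_smul, inv_smul_smul]

lemma HolomorphicAt.comp_aut {f : X → Sphere} {x : X} (F : Aut X) (hf : HolomorphicAt f (F x)) :
    HolomorphicAt (f ∘ F) x := by
  obtain ⟨hc, g, hg, hd⟩ := hf
  exact ⟨hc.comp F.continuous.continuousAt, g, hg, hd.comp x (F.mdifferentiable (by simp) x)⟩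

lemma push_mem_P {σ : ProjectiveStructure X} (hσ : σ ∈ P X) (F : Aut X) :
    σ.push F.toHomeomorph ∈ P X := by
  rintro _ ⟨φ, hφ, rfl⟩ x hx
  exact (hσ φ hφ (F.symm x) hx).comp_aut F.symm

variable [IsManifold 𝓘(ℂ) ω X] {σ₀ : ProjectiveStructure X} (hσ₀ : σ₀ ∈ P X)

include hσ₀

lemma isSchwarzianAt_S {σ : ProjectiveStructure X} (hσ : σ ∈ P X)
    {ψ : OpenPartialHomeomorph X Sphere} (hψ : ψ ∈ σ.charts) {x : X} (hx : x ∈ ψ.source) :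
    IsSchwarzianAt σ₀ ψ x (S σ₀ σ x) := by
  have h := conformalAt_of_mem_P hσ (σ.chart_mem x) (σ.mem_chart_source x)
  exact (isSchwarzianAt_schwarzianAt hσ₀ h).of_moebRelated hσ₀ h (conformalAt_of_mem_P hσ hψ hx)
    (σ.compatible _ (σ.chart_mem x) ψ hψ x ⟨σ.mem_chart_source x, hx⟩)

lemma S_mem_H0K2 {σ : ProjectiveStructure X} (hσ : σ ∈ P X) : S σ₀ σ ∈ H0K2 X := by
  intro e he t ht
  have hγ := IsParam.of_atlas he ht
  have hψ := σ.chart_mem (e.symm t)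
  have hφ := σ₀.chart_mem (e.symm t)
  have htψ := σ.mem_chart_source (e.symm t)
  have htφ := σ₀.mem_chart_source (e.symm t)
  set ψ := σ.chart (e.symm t)
  set φ := σ₀.chart (e.symm t)
  have han := (hγ.sphereConformal (conformalAt_of_mem_P hσ hψ htψ)).analyticAt_sphereSchwarzian.sub
    (hγ.sphereConformal (conformalAt_of_mem_P hσ₀ hφ htφ)).analyticAt_sphereSchwarzian
  -- The definition of `S` uses charts that vary with the point; by chart independence, those chosen
  -- at `e.symm t` serve for all nearby points.
  refine (han.differentiableAt.congr_of_eventuallyEq ?_).differentiableWithinAt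
  filter_upwards [hγ.eventually, hγ.continuousAt (ψ.open_source.mem_nhds htψ),
    hγ.continuousAt (φ.open_source.mem_nhds htφ)] with s h1 h2 h3
  exact (isSchwarzianAt_S hσ₀ hσ hψ h2).apply_velocity hσ₀ h1 (conformalAt_of_mem_P hσ hψ h2) hφ h3

lemma S_injOn : InjOn (S σ₀) (P X) := by
  intro σ hσ σ' hσ' h
  refine ProjectiveStructure.eq_of_moebRelated fun φ hφ ψ hψ x hx => ?_
  refine moebRelated_of_isSchwarzianAt hσ₀ (q := S σ₀ σ) (conformalAt_of_mem_P hσ hφ hx.1)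
    (conformalAt_of_mem_P hσ' hψ hx.2) ?_ ?_
  · filter_upwards [φ.open_source.mem_nhds hx.1] with y hy using isSchwarzianAt_S hσ₀ hσ hφ hy
  · rw [h]
    filter_upwards [ψ.open_source.mem_nhds hx.2] with y hy using isSchwarzianAt_S hσ₀ hσ' hψ hy

/-- A conformal chart around `x` whose Schwarzian derivative is a given quadratic differential. -/
lemma exists_chart_isSchwarzianAt {q : KSqSection X} (hq : q ∈ H0K2 X) (x : X) :
    ∃ ψ : OpenPartialHomeomorph X Sphere, x ∈ ψ.source ∧
      ∀ y ∈ ψ.source, HolomorphicAt ψ y ∧ IsSchwarzianAt σ₀ ψ y (q y) := by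
  have : IsManifold 𝓘(ℂ) 1 X := IsManifold.of_le (n := ω) le_top
  set e := chartAt ℂ x
  have he : e ∈ atlas ℂ X := chart_mem_atlas ℂ x
  have hxe : x ∈ e.source := mem_chart_source ℂ x
  have ht := e.map_source hxe
  set t := e x
  have hx : e.symm t = x := e.left_inv hxe
  have hγ := IsParam.of_atlas he ht
  have hφ := σ₀.chart_mem (e.symm t)
  have htφ := σ₀.mem_chart_source (e.symm t)
  set φ := σ₀.chart (e.symm t)
  have hqa : AnalyticAt ℂ (coeff X q e) t := (hq e he).analyticAt (e.open_target.mem_nhds ht)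
  -- The Schwarzian of `φ` along `e.symm` is added in advance, so that subtracting it leaves the
  -- coefficient of `q`.
  obtain ⟨f, hf, hfS⟩ := exists_conformal_schwarzian_eq (hqa.add
    (hγ.sphereConformal (conformalAt_of_mem_P hσ₀ hφ htφ)).analyticAt_sphereSchwarzian)
  let R : OpenPartialHomeomorph ℂ ℂ :=
    (hf.1.hasStrictDerivAt.hasStrictFDerivAt_equiv hf.2).toOpenPartialHomeomorph f
  have hRt : t ∈ R.source := HasStrictFDerivAt.mem_toOpenPartialHomeomorph_source _
  have hRf : ∀ s, R s = f s := fun _ => rfl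
  -- On `V` the solution stays conformal, the Schwarzian equation holds, and `e.symm` stays in the
  -- domain of `φ`.
  obtain ⟨V, hV, hVo, htV⟩ := eventually_nhds_iff.1
    (hf.eventually.and (hfS.and (hγ.continuousAt (φ.open_source.mem_nhds htφ))))
  let ι : OpenPartialHomeomorph ℂ Sphere :=
    OnePoint.isOpenEmbedding_coe.toOpenPartialHomeomorph ((↑) : ℂ → Sphere)
  let ψ := (e.trans (R.restrOpen V hVo)).trans ι
  have hψ : ∀ y, ψ y = (f (e y) : Sphere) := fun _ => rfl
  have hsrc : ∀ y, y ∈ ψ.source ↔ y ∈ e.source ∧ e y ∈ R.source ∧ e y ∈ V := by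
    intro y
    simp [ψ, ι]
  have hhol : ∀ y ∈ ψ.source, HolomorphicAt ψ y := by
    intro y hy
    refine ⟨ψ.continuousAt hy, 1, by simp [hψ], ?_⟩
    have h1 := (hV _ ((hsrc y).1 hy).2.2).1.1.differentiableAt.mdifferentiableAt.comp y
      (mdifferentiableAt_atlas he ((hsrc y).1 hy).1)
    simp only [one_smul]
    exact h1
  refine ⟨ψ, (hsrc x).2 ⟨hxe, hRt, htV⟩, fun y hy => ⟨hhol y hy, ?_⟩⟩
  have hψc : ConformalAt ψ y := conformalAt_of_holomorphicAt hhol hy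
  obtain ⟨hye, -, hyV⟩ := (hsrc y).1 hy
  obtain ⟨hfc, hfs, hyφ⟩ := hV _ hyV
  have hs := e.map_source hye
  have hys : e.symm (e y) = y := e.left_inv hye
  generalize e y = s at *
  subst hys
  refine isSchwarzianAt_of_apply_velocity hσ₀ (IsParam.of_atlas he hs) hψc hφ hyφ ?_
  have hψe : ψ ∘ e.symm =ᶠ[𝓝 s] fun r => (f r : Sphere) := by
    filter_upwards [e.open_target.mem_nhds hs] with r hr
    rw [Function.comp, hψ, e.right_inv hr]
  rw [sphereSchwarzian_congr hψe, hfc.sphereSchwarzian_coe, hfs]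
  exact (add_sub_cancel_right _ _).symm

/-- The atlas consists of all holomorphic charts with Schwarzian derivative `q`. Since both
conditions are invariant under Moebius post-composition, any chart compatible with the atlas
satisfies them, which is maximality. -/
lemma exists_mem_P_S_eq {q : KSqSection X} (hq : q ∈ H0K2 X) : ∃ σ ∈ P X, S σ₀ σ = q := by
  have hconf : ∀ ψ : OpenPartialHomeomorph X Sphere,
      (∀ y ∈ ψ.source, HolomorphicAt ψ y ∧ IsSchwarzianAt σ₀ ψ y (q y)) →
      ∀ x ∈ ψ.source, ConformalAt ψ x :=
    fun ψ hψ x hx => conformalAt_of_holomorphicAt (fun y hy => (hψ y hy).1) hx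
  let σ : ProjectiveStructure X :=
    { charts := {ψ | ∀ y ∈ ψ.source, HolomorphicAt ψ y ∧ IsSchwarzianAt σ₀ ψ y (q y)}
      cover := fun x => by
        obtain ⟨ψ, hx, hψ⟩ := exists_chart_isSchwarzianAt hσ₀ hq x
        exact ⟨ψ, hψ, hx⟩
      compatible := fun φ hφ ψ hψ x hx => by
        refine moebRelated_of_isSchwarzianAt hσ₀ (q := q) (hconf φ hφ x hx.1)
          (hconf ψ hψ x hx.2) ?_ ?_
        · filter_upwards [φ.open_source.mem_nhds hx.1] with y hy using (hφ y hy).2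
        · filter_upwards [ψ.open_source.mem_nhds hx.2] with y hy using (hψ y hy).2
      maximal := fun ψ h => by
        have hhol : ∀ y ∈ ψ.source, HolomorphicAt ψ y := fun y hy => by
          obtain ⟨φ, hyφ, hφ⟩ := exists_chart_isSchwarzianAt hσ₀ hq y
          exact (hφ y hyφ).1.of_moebRelated (ψ.continuousAt hy) (h φ hφ y ⟨hyφ, hy⟩)
        intro y hy
        have hψ : ConformalAt ψ y := conformalAt_of_holomorphicAt hhol hy
        obtain ⟨φ, hyφ, hφ⟩ := exists_chart_isSchwarzianAt hσ₀ hq y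
        exact ⟨hhol y hy, (hφ y hyφ).2.of_moebRelated hσ₀ (hconf φ hφ y hyφ) hψ
          (h φ hφ y ⟨hyφ, hy⟩)⟩ }
  have hσ : σ ∈ P X := fun φ hφ x hx => (hφ x hx).1
  refine ⟨σ, hσ, funext fun x => ?_⟩
  have hx := σ.mem_chart_source x
  exact (isSchwarzianAt_S hσ₀ hσ (σ.chart_mem x) hx).unique (σ.chart_mem x x hx).2

/-! ### The action of the automorphism group -/

/-- The maps `φ ∘ F⁻¹` differentiated on the left are charts of `F.σ₀`. -/
lemma translation_eq_S_push (F : Aut X) : translation σ₀ F = S σ₀ (σ₀.push F.toHomeomorph) := by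
  funext x
  have hP := push_mem_P hσ₀ F
  have hφ : F.toHomeomorph.symm.transOpenPartialHomeomorph (σ₀.chart (F.symm x)) ∈
      (σ₀.push F.toHomeomorph).charts := ⟨_, σ₀.chart_mem (F.symm x), rfl⟩
  have hx : x ∈ (F.toHomeomorph.symm.transOpenPartialHomeomorph (σ₀.chart (F.symm x))).source :=
    σ₀.mem_chart_source (F.symm x)
  have hc := conformalAt_of_mem_P hP hφ hx
  exact (isSchwarzianAt_schwarzianAt hσ₀ hc).unique (isSchwarzianAt_S hσ₀ hP hφ hx)

/-- On a velocity, the pull-back term is the number of `σ` minus that of `σ₀`, both along `F⁻¹ ∘ γ`;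
the translation is the number of `σ₀` along `F⁻¹ ∘ γ` minus that along `γ`. The sum telescopes. -/
lemma S_push (F : Aut X) {σ : ProjectiveStructure X} (hσ : σ ∈ P X) :
    S σ₀ (σ.push F.toHomeomorph) = act σ₀ F (S σ₀ σ) := by
  have key : ∀ {τ : ProjectiveStructure X}, τ ∈ P X →
      ∀ {γ : ℂ → X} {t : ℂ}, IsParam γ t → ∀ {φ : OpenPartialHomeomorph X Sphere}, φ ∈ τ.charts →
      F.symm (γ t) ∈ φ.source →
      S σ₀ (τ.push F.toHomeomorph) (γ t) (velocity γ t) (velocity γ t) =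
        sphereSchwarzian (φ ∘ (F.symm ∘ γ)) t - sphereSchwarzian (σ₀.chart (γ t) ∘ γ) t := by
    intro τ hτ γ t hγ φ hφ ht
    have hP := push_mem_P hτ F
    have hφ' : F.toHomeomorph.symm.transOpenPartialHomeomorph φ ∈
      (τ.push F.toHomeomorph).charts := ⟨φ, hφ, rfl⟩
    exact (isSchwarzianAt_S hσ₀ hP hφ' ht).apply_velocity hσ₀ hγ
      (conformalAt_of_mem_P hP hφ' ht) (σ₀.chart_mem (γ t)) (σ₀.mem_chart_source (γ t))
  funext x
  obtain ⟨γ, t, hγ, rfl⟩ := exists_isParam x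
  refine KSqFibre.ext_of_ne_zero (hγ.velocity_ne_zero
    (conformalAt_of_mem_P hσ₀ (σ₀.chart_mem (γ t)) (σ₀.mem_chart_source (γ t)))) ?_
  have hφ := σ.chart_mem (F.symm (γ t))
  have hφt := σ.mem_chart_source (F.symm (γ t))
  have hz := σ₀.chart_mem (F.symm (γ t))
  have hzt := σ₀.mem_chart_source (F.symm (γ t))
  have hD : mfderiv 𝓘(ℂ) 𝓘(ℂ) F.symm (γ t) (velocity γ t) = velocity (F.symm ∘ γ) t :=
    (mfderiv_comp_apply t (F.symm.mdifferentiable (by simp) (γ t)) hγ.1.self_of_nhds (1 : ℂ)).symm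
  have hpull : pullAt F (S σ₀ σ) (γ t) (velocity γ t) (velocity γ t) =
      sphereSchwarzian (σ.chart (F.symm (γ t)) ∘ (F.symm ∘ γ)) t -
        sphereSchwarzian (σ₀.chart (F.symm (γ t)) ∘ (F.symm ∘ γ)) t := by
    change S σ₀ σ (F.symm (γ t)) (mfderiv 𝓘(ℂ) 𝓘(ℂ) F.symm (γ t) (velocity γ t))
      (mfderiv 𝓘(ℂ) 𝓘(ℂ) F.symm (γ t) (velocity γ t)) = _
    rw [hD]
    exact (isSchwarzianAt_S hσ₀ hσ hφ hφt).apply_velocity hσ₀ (hγ.comp_aut F.symm)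
      (conformalAt_of_mem_P hσ hφ hφt) hz hzt
  have htr := key hσ₀ hγ hz hzt
  rw [← translation_eq_S_push hσ₀ F] at htr
  change _ = pullAt F (S σ₀ σ) (γ t) (velocity γ t) (velocity γ t) +
    translation σ₀ F (γ t) (velocity γ t) (velocity γ t)
  rw [key hσ hγ hφ hφt, hpull, htr]
  ring

lemma act_mem_H0K2 (F : Aut X) {q : KSqSection X} (hq : q ∈ H0K2 X) : act σ₀ F q ∈ H0K2 X := by
  obtain ⟨σ, hσ, rfl⟩ := exists_mem_P_S_eq hσ₀ hq
  rw [← S_push hσ₀ F hσ]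
  exact S_mem_H0K2 hσ₀ (push_mem_P hσ F)

lemma translation_mem_H0K2 (F : Aut X) : translation σ₀ F ∈ H0K2 X := by
  rw [translation_eq_S_push hσ₀ F]
  exact S_mem_H0K2 hσ₀ (push_mem_P hσ₀ F)

lemma pull_mem_H0K2 (F : Aut X) {q : KSqSection X} (hq : q ∈ H0K2 X) : pull F q ∈ H0K2 X := by
  intro e he
  -- The pull-back is `F.q` minus the translation, both already known to be holomorphic, so no
  -- computation in charts is needed.
  refine ((act_mem_H0K2 hσ₀ F hq e he).sub (translation_mem_H0K2 hσ₀ F e he)).congr fun t _ => ?_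
  exact (sub_eq_of_eq_add (show coeff X (act σ₀ F q) e t =
    coeff X (pull F q) e t + coeff X (translation σ₀ F) e t from rfl)).symm

lemma act_refl {q : KSqSection X} (hq : q ∈ H0K2 X) :
    act σ₀ (Diffeomorph.refl 𝓘(ℂ) X ω) q = q := by
  obtain ⟨σ, hσ, rfl⟩ := exists_mem_P_S_eq hσ₀ hq
  rw [← S_push hσ₀ _ hσ]
  exact congrArg (S σ₀) σ.push_refl

lemma act_trans (F G : Aut X) {q : KSqSection X} (hq : q ∈ H0K2 X) :
    act σ₀ (G.trans F) q = act σ₀ F (act σ₀ G q) := by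
  obtain ⟨σ, hσ, rfl⟩ := exists_mem_P_S_eq hσ₀ hq
  rw [← S_push hσ₀ _ hσ, ← S_push hσ₀ _ hσ, ← S_push hσ₀ _ (push_mem_P hσ G)]
  exact congrArg (S σ₀) (σ.push_trans F.toHomeomorph G.toHomeomorph)

lemma mem_Mob_iff_act_eq (F : Aut X) {σ : ProjectiveStructure X} (hσ : σ ∈ P X) :
    F.toHomeomorph ∈ σ.Mob ↔ act σ₀ F (S σ₀ σ) = S σ₀ σ := by
  rw [ProjectiveStructure.mem_Mob_iff, ← S_push hσ₀ F hσ,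
    (S_injOn hσ₀).eq_iff (push_mem_P hσ F) hσ]

lemma isSchwarzianOnCover_S {Y : Type*} [TopologicalSpace Y] {p : Y → X} (hp : IsLocalHomeomorph p)
    {σ : ProjectiveStructure X} (hσ : σ ∈ P X) {dev : Y → Sphere} (hdev : σ.IsDevelopingMap p dev) :
    IsSchwarzianOnCover σ₀ p dev (S σ₀ σ) := by
  intro y f' hf'
  obtain ⟨φ, hφ, hy, heq⟩ := hdev y
  -- Since `p` is a local homeomorphism, it maps neighbourhoods of `y` onto those of `p y`, and
  -- equality of germs upstairs descends to `X`.
  have h : ∀ᶠ x in map p (𝓝 y), φ x = f' x := heq.symm.trans hf'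
  rw [hp.map_nhds_eq y] at h
  exact (isSchwarzianAt_S hσ₀ hσ hφ hy).congr hσ₀ (conformalAt_of_mem_P hσ hφ hy) h

end

end ProjStruct

end

theorem mainTheorem3 {X : Type*} [TopologicalSpace X] [T2Space X] [ConnectedSpace X]
    [ChartedSpace ℂ X] [IsManifold 𝓘(ℂ) ω X]
    (σ₀ : ProjStruct.ProjectiveStructure X) (hσ₀ : σ₀ ∈ ProjStruct.P X) :
    -- `𝒮_{σ₀}(σ)` may be computed in any charts, and `𝒮_{σ₀}` identifies `𝒫(X)` with `H⁰(X, K²)`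
    (∀ σ ∈ ProjStruct.P X, ∀ ψ ∈ σ.charts, ∀ x ∈ ψ.source,
      ProjStruct.IsSchwarzianAt σ₀ ψ x (ProjStruct.S σ₀ σ x)) ∧
    Set.BijOn (ProjStruct.S σ₀) (ProjStruct.P X) (ProjStruct.H0K2 X) ∧
    -- the same for `𝒮_{σ₀}(F⁻¹)`
    (∀ F : ProjStruct.Aut X,
      (∀ φ ∈ σ₀.charts, ∀ x, F.symm x ∈ φ.source →
        ProjStruct.IsSchwarzianAt σ₀ (φ ∘ F.symm) x (ProjStruct.translation σ₀ F x)) ∧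
      ProjStruct.translation σ₀ F ∈ ProjStruct.H0K2 X) ∧
    -- description through developing maps on a universal covering
    (∀ (Y : Type*) [TopologicalSpace Y] [SimplyConnectedSpace Y] (p : Y → X), IsCoveringMap p →
      (∀ σ ∈ ProjStruct.P X, ∀ dev : Y → ProjStruct.Sphere, σ.IsDevelopingMap p dev →
        ProjStruct.IsSchwarzianOnCover σ₀ p dev (ProjStruct.S σ₀ σ)) ∧
      ∀ (F : ProjStruct.Aut X) (Ft : Y ≃ₜ Y), (∀ y, p (Ft y) = F (p y)) →
        (∀ σ ∈ ProjStruct.P X, ∀ dev : Y → ProjStruct.Sphere, σ.IsDevelopingMap p dev →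
          (σ.push F.toHomeomorph).IsDevelopingMap p (dev ∘ Ft.symm)) ∧
        ∀ dev₀ : Y → ProjStruct.Sphere, σ₀.IsDevelopingMap p dev₀ →
          ProjStruct.IsSchwarzianOnCover σ₀ p (dev₀ ∘ Ft.symm) (ProjStruct.translation σ₀ F)) ∧
    -- `(F, q) ↦ F.q` is the action of `Aut(X)` on `H⁰(X, K²)` induced by `(F, σ) ↦ F.σ`
    (∀ F : ProjStruct.Aut X, ∀ σ ∈ ProjStruct.P X,
      σ.push F.toHomeomorph ∈ ProjStruct.P X ∧
      ProjStruct.S σ₀ (σ.push F.toHomeomorph) = ProjStruct.act σ₀ F (ProjStruct.S σ₀ σ)) ∧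
    (∀ F : ProjStruct.Aut X, ∀ q ∈ ProjStruct.H0K2 X,
      ProjStruct.pull F q ∈ ProjStruct.H0K2 X ∧ ProjStruct.act σ₀ F q ∈ ProjStruct.H0K2 X) ∧
    (∀ q ∈ ProjStruct.H0K2 X, ProjStruct.act σ₀ (Diffeomorph.refl 𝓘(ℂ) X ω) q = q) ∧
    (∀ F G : ProjStruct.Aut X, ∀ q ∈ ProjStruct.H0K2 X,
      ProjStruct.act σ₀ (G.trans F) q = ProjStruct.act σ₀ F (ProjStruct.act σ₀ G q)) ∧
    -- the criterion
    ∀ F : ProjStruct.Aut X, ∀ σ ∈ ProjStruct.P X,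
      F.toHomeomorph ∈ σ.Mob ↔ ProjStruct.act σ₀ F (ProjStruct.S σ₀ σ) = ProjStruct.S σ₀ σ := by
  open ProjStruct in
  refine ⟨fun σ hσ ψ hψ x hx => isSchwarzianAt_S hσ₀ hσ hψ hx,
    ⟨fun σ hσ => S_mem_H0K2 hσ₀ hσ, S_injOn hσ₀, fun q hq => exists_mem_P_S_eq hσ₀ hq⟩,
    fun F => ⟨fun φ hφ x hx => ?_, translation_mem_H0K2 hσ₀ F⟩,
    fun Y _ _ p hp => ⟨fun σ hσ dev hdev =>
      isSchwarzianOnCover_S hσ₀ hp.isLocalHomeomorph hσ hdev, fun F Ft hF =>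
      ⟨fun σ _ dev hdev => hdev.push hF, fun dev₀ hdev₀ => ?_⟩⟩,
    fun F σ hσ => ⟨push_mem_P hσ F, S_push hσ₀ F hσ⟩,
    fun F q hq => ⟨pull_mem_H0K2 hσ₀ F hq, act_mem_H0K2 hσ₀ F hq⟩,
    fun q hq => act_refl hσ₀ hq, fun F G q hq => act_trans hσ₀ F G hq,
    fun F σ hσ => mem_Mob_iff_act_eq hσ₀ F hσ⟩
  · rw [translation_eq_S_push hσ₀ F]
    have hmem : F.toHomeomorph.symm.transOpenPartialHomeomorph φ ∈
      (σ₀.push F.toHomeomorph).charts := ⟨φ, hφ, rfl⟩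
    exact isSchwarzianAt_S hσ₀ (push_mem_P hσ₀ F) hmem hx
  · rw [translation_eq_S_push hσ₀ F]
    exact isSchwarzianOnCover_S hσ₀ hp.isLocalHomeomorph (push_mem_P hσ₀ F) (hdev₀.push hF)
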